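/- Let $(A,\mathfrak m)$ be a Noetherian local ring and let $I \subsetneq A$ be a proper ideal. Let $R(I)=\bigoplus_{n\ge 0} I^n t^n\subseteq A[t]$ be the Rees algebra of $I$, let $F(I)=R(I)/\mathfrak m R(I)=\bigoplus_{n\ge 0} I^n/\mathfrak m I^n$ be its fiber cone, and let $$R(\mathcal F)=A\oplus \mathfrak m t\oplus \mathfrak m I t^2\oplus \mathfrak m I^2t^3\oplus\cdots\subseteq A[t]$$ be the Rees module of the filtration $\mathcal F: A\supseteq \mathfrak m\supseteq \mathfrak m I\supseteq \mathfrak m I^2\supseteq\cdots$; all three are graded $R(I)$-modules. Let $R(I)_+$ be the ideal of $R(I)$ generated by the homogeneous elements of positive degree. For a graded $R(I)$-module $M$ let $H^i(M)=H^i_{R(I)_+}(M)$ be the $i$-th local cohomology module with its natural grading, that is, the $i$-th cohomology of the Čech complex of $M$ on any finite family of homogeneous elements of positive degree generating $R(I)_+$. Put $a_i(M)=\sup\{n\in\mathbb Z : H^i(M)_n\ne 0\}$ (which is $-\infty$ if $H^i(M)=0$) and $$\operatorname{reg} M=\sup\{a_i(M)+i : i\ge 0\}.$$ If $\operatorname{reg}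 R(\mathcal F)\le \operatorname{reg} R(I)$, then $\operatorname{reg} F(I)=\operatorname{reg} R(I)$. -/

import Mathlib

open Polynomial IsLocalRing

noncomputable section

namespace FiberReg

/-! Graded local cohomology, `a`-invariants and Castelnuovo-Mumford regularity.

`S` is a `ℤ`-graded ring and `M` a `ℤ`-graded `S`-module, with homogeneous components
`𝒮 n` and `ℳ n`.  Local cohomology with support in the ideal generated by a finite family
`f` of homogeneous elements is the cohomology of the Čech complex on `f`. -/

section LocalCohomology

variable {S M : Type*} [CommRing S] [AddCommGroup M] [Module S M] {r : ℕ}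

/-- The ideal `S₊` generated by the homogeneous elements of positive degree. -/
def positiveIdeal (𝒮 : ℤ → AddSubgroup S) : Ideal S :=
  Ideal.span {x | ∃ n : ℤ, 0 < n ∧ x ∈ 𝒮 n}

/-- `f₁, …, f_r` are homogeneous elements of positive degree that generate the ideal `S₊`. -/
structure IsPositiveGenerators (𝒮 : ℤ → AddSubgroup S) (f : Fin r → S) : Prop where
  homogeneous : ∀ j, ∃ n : ℤ, 0 < n ∧ f j ∈ 𝒮 n
  span_eq : Ideal.span (Set.range f) = positiveIdeal 𝒮

/-- The multiplicative set generated by the `f j`, `j ∈ J`. -/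
abbrev cechMonoid (f : Fin r → S) (J : Finset (Fin r)) : Submonoid S :=
  Submonoid.closure (f '' (J : Set (Fin r)))

variable (M) in
/-- The localization of `M` that inverts all `f j`, `j ∈ J` (equivalently, their product). -/
abbrev CechLoc (f : Fin r → S) (J : Finset (Fin r)) : Type _ :=
  LocalizedModule (cechMonoid f J) M

lemma cechMonoid_mono (f : Fin r → S) {J K : Finset (Fin r)} (h : J ⊆ K) :
    cechMonoid f J ≤ cechMonoid f K :=
  Submonoid.closure_mono (Set.image_mono (Finset.coe_subset.mpr h))

variable (M) in
/-- The canonical map between localizations, `m / s ↦ m / s`. -/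
def cechRes (f : Fin r → S) {J K : Finset (Fin r)} (h : J ⊆ K) :
    CechLoc M f J →ₗ[S] CechLoc M f K :=
  LocalizedModule.liftOfLE (cechMonoid f J) (cechMonoid f K) (cechMonoid_mono f h)

variable (M) in
/-- The `i`-th term of the Čech complex, `⨁ M_{f_{j₁} ⋯ f_{j_i}}` over `j₁ < ⋯ < j_i`. -/
abbrev CechCochain (f : Fin r → S) (i : ℕ) : Type _ :=
  (J : {J : Finset (Fin r) // J.card = i}) → CechLoc M f J.1

variable (M) in
/-- The Čech differential: the `J`-component of `d z` is the alternating sum of the images of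
the components `z_{J ∖ j}`, `j ∈ J`, with sign `(-1) ^ #{k ∈ J | k < j}`. -/
def cechD (f : Fin r → S) (i : ℕ) : CechCochain M f i →ₗ[S] CechCochain M f (i + 1) :=
  LinearMap.pi fun J => ∑ j : {j // j ∈ J.1},
    ((-1 : ℤ) ^ (J.1.filter (· < j.1)).card) •
      (cechRes M f (Finset.erase_subset j.1 J.1)).comp
        (LinearMap.proj (⟨J.1.erase j.1, by
          rw [Finset.card_erase_of_mem j.2, J.2, Nat.add_sub_cancel]⟩ :
            {K : Finset (Fin r) // K.card = i}))

/-- The homogeneous component of degree `n` of a localization: the fractions `m / s` with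
`s` homogeneous of some degree `d` and `m` homogeneous of degree `n + d`. -/
def cechLocDegree (𝒮 : ℤ → AddSubgroup S) [SetLike.GradedMonoid 𝒮]
    (ℳ : ℤ → AddSubgroup M) [SetLike.GradedSMul 𝒮 ℳ]
    (f : Fin r → S) (J : Finset (Fin r)) (n : ℤ) : AddSubgroup (CechLoc M f J) where
  carrier := {x | ∃ (d : ℤ) (s : cechMonoid f J) (m : M),
    (s : S) ∈ 𝒮 d ∧ m ∈ ℳ (n + d) ∧ x = LocalizedModule.mk m s}
  zero_mem' := ⟨0, 1, 0, SetLike.GradedOne.one_mem, zero_mem _,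
    (LocalizedModule.zero_mk _).symm⟩
  add_mem' := by
    rintro _ _ ⟨d, s, m, hs, hm, rfl⟩ ⟨e, t, l, ht, hl, rfl⟩
    refine ⟨d + e, s * t, t • m + s • l, SetLike.GradedMul.mul_mem hs ht, add_mem ?_ ?_,
      LocalizedModule.mk_add_mk⟩
    · have := SetLike.GradedSMul.smul_mem ht hm
      rwa [vadd_eq_add, show e + (n + d) = n + (d + e) by ring] at this
    · have := SetLike.GradedSMul.smul_mem hs hl
      rwa [vadd_eq_add, show d + (n + e) = n + (d + e) by ring] at this
  neg_mem' := by
    rintro _ ⟨d, s, m, hs, hm, rfl⟩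
    exact ⟨d, s, -m, hs, neg_mem hm, LocalizedModule.mk_neg.symm⟩

section Graded

variable (𝒮 : ℤ → AddSubgroup S) [SetLike.GradedMonoid 𝒮]
  (ℳ : ℤ → AddSubgroup M) [SetLike.GradedSMul 𝒮 ℳ] (f : Fin r → S)

/-- The Čech cochains of degree `n`. -/
def cechDegree (i : ℕ) (n : ℤ) : AddSubgroup (CechCochain M f i) :=
  AddSubgroup.pi Set.univ fun J => cechLocDegree 𝒮 ℳ f J.1 n

/-- The Čech cocycles of degree `n`. -/
def cechCocycles (i : ℕ) (n : ℤ) : AddSubgroup (CechCochain M f i) :=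
  cechDegree 𝒮 ℳ f i n ⊓ (cechD M f i).toAddMonoidHom.ker

/-- The Čech coboundaries of degree `n`. -/
def cechCoboundaries : (i : ℕ) → (n : ℤ) → AddSubgroup (CechCochain M f i)
  | 0, _ => ⊥
  | i + 1, n => (cechDegree 𝒮 ℳ f i n).map (cechD M f i).toAddMonoidHom

/-- The homogeneous component of degree `n` of the `i`-th local cohomology module of `M` with
support in the ideal generated by `f`. -/
abbrev LocalCohomologyDegree (i : ℕ) (n : ℤ) : Type _ :=
  ↥(cechCocycles 𝒮 ℳ f i n) ⧸
    (cechCoboundaries 𝒮 ℳ f i n).addSubgroupOf (cechCocycles 𝒮 ℳ f i n)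

/-- `a_i(M)`, the largest degree in which the `i`-th local cohomology module is not zero, and
`-∞` if that module is zero. -/
def aInvariant (i : ℕ) : EReal :=
  ⨆ (n : ℤ) (_ : Nontrivial (LocalCohomologyDegree 𝒮 ℳ f i n)), ((n : ℝ) : EReal)

/-- The Castelnuovo-Mumford regularity `max {a_i(M) + i | i ≥ 0}`; here `f` generates `S₊`. -/
def reg : EReal :=
  ⨆ i : ℕ, aInvariant 𝒮 ℳ f i + (i : EReal)

end Graded

end LocalCohomology

/-! The Rees algebra `R(I)`, the Rees module `R(𝓕)` and the fiber cone `F(I)`, as graded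
`R(I)`-modules. -/

section Blowup

variable {A : Type*} [CommRing A]

/-- The polynomials that are homogeneous of degree `n` (only `0` for negative `n`). -/
def polyDegree (A : Type*) [CommRing A] (n : ℤ) : AddSubgroup A[X] where
  carrier := {p | ∀ k : ℕ, (k : ℤ) ≠ n → p.coeff k = 0}
  zero_mem' := by simp
  add_mem' := by
    intro p q hp hq k hk
    rw [coeff_add, hp k hk, hq k hk, add_zero]
  neg_mem' := by
    intro p hp k hk
    rw [coeff_neg, hp k hk, neg_zero]

lemma polyDegree_mul {p q : A[X]} {a b : ℤ} (hp : p ∈ polyDegree A a)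
    (hq : q ∈ polyDegree A b) : p * q ∈ polyDegree A (a + b) := by
  intro k hk
  rw [coeff_mul]
  refine Finset.sum_eq_zero fun x hx => ?_
  rw [Finset.HasAntidiagonal.mem_antidiagonal] at hx
  by_cases h : (x.1 : ℤ) = a
  · rw [hq x.2 (by omega), mul_zero]
  · rw [hp x.1 h, zero_mul]

lemma polyDegree_one : (1 : A[X]) ∈ polyDegree A 0 := by
  intro k hk
  rw [coeff_one, if_neg (by exact_mod_cast hk)]

/-- The component `Iⁿ tⁿ` of the Rees algebra. -/
def reesDegree (I : Ideal A) (n : ℤ) : AddSubgroup (reesAlgebra I) :=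
  (polyDegree A n).comap (reesAlgebra I).val.toLinearMap.toAddMonoidHom

instance (I : Ideal A) : SetLike.GradedMonoid (reesDegree I) where
  one_mem := polyDegree_one
  mul_mem _ _ _ _ hp hq := polyDegree_mul hp hq

instance (I : Ideal A) : SetLike.GradedSMul (reesDegree I) (reesDegree I) where
  smul_mem _ _ _ _ hp hq := polyDegree_mul hp hq

variable [IsLocalRing A]

/-- `R(𝓕) = A ⊕ 𝔪 t ⊕ 𝔪 I t² ⊕ 𝔪 I² t³ ⊕ ⋯` inside `A[t]`, an `R(I)`-module as `I ⊆ 𝔪`. -/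
def filtrationRees (I : Ideal A) (hI : I ≠ ⊤) : Submodule (reesAlgebra I) A[X] where
  carrier := {p | ∀ n : ℕ, p.coeff (n + 1) ∈ maximalIdeal A * I ^ n}
  zero_mem' := by simp
  add_mem' := by
    intro p q hp hq n
    rw [coeff_add]
    exact add_mem (hp n) (hq n)
  smul_mem' := by
    intro c p hp n
    have hIm : I ≤ maximalIdeal A := le_maximalIdeal hI
    change ((c : A[X]) * p).coeff (n + 1) ∈ _
    rw [coeff_mul]
    refine sum_mem ?_
    rintro ⟨a, b⟩ hab
    rw [Finset.HasAntidiagonal.mem_antidiagonal] at hab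
    have hc := c.2 a
    rcases b with _ | b
    · have ha : a = n + 1 := by simpa using hab
      subst ha
      rw [pow_succ'] at hc
      exact Ideal.mul_mem_right _ _ (Ideal.mul_mono_left hIm hc)
    · have hn : n = a + b := by simp only at hab; omega
      have h := Ideal.mul_mem_mul hc (hp b)
      rwa [mul_left_comm, ← pow_add, ← hn] at h

/-- The component of degree `n` of `R(𝓕)`. -/
def filtrationReesDegree (I : Ideal A) (hI : I ≠ ⊤) (n : ℤ) :
    AddSubgroup (filtrationRees I hI) :=
  (polyDegree A n).comap (filtrationRees I hI).subtype.toAddMonoidHom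

instance (I : Ideal A) (hI : I ≠ ⊤) :
    SetLike.GradedSMul (reesDegree I) (filtrationReesDegree I hI) where
  smul_mem _ _ _ _ hp hq := polyDegree_mul hp hq

/-- The extension `𝔪 R(I)` of the maximal ideal to the Rees algebra. -/
def maximalExt (I : Ideal A) : Ideal (reesAlgebra I) :=
  (maximalIdeal A).map (algebraMap A (reesAlgebra I))

/-- The fiber cone `F(I) = R(I) / 𝔪 R(I) = ⨁ Iⁿ / 𝔪 Iⁿ`, with its `R(I)`-module structure. -/
def FiberCone (I : Ideal A) : Type _ :=
  reesAlgebra I ⧸ maximalExt I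

instance (I : Ideal A) : AddCommGroup (FiberCone I) :=
  inferInstanceAs (AddCommGroup (reesAlgebra I ⧸ maximalExt I))

instance (I : Ideal A) : Module (reesAlgebra I) (FiberCone I) :=
  Submodule.Quotient.module (maximalExt I)

/-- The quotient map `R(I) → F(I)`. -/
def toFiberCone (I : Ideal A) : reesAlgebra I →ₗ[reesAlgebra I] FiberCone I :=
  Submodule.mkQ (maximalExt I)

/-- The component `Iⁿ / 𝔪 Iⁿ` of the fiber cone: the image of `Iⁿ tⁿ`. -/
def fiberConeDegree (I : Ideal A) (n : ℤ) : AddSubgroup (FiberCone I) :=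
  (reesDegree I n).map (toFiberCone I).toAddMonoidHom

instance (I : Ideal A) : SetLike.GradedSMul (reesDegree I) (fiberConeDegree I) where
  smul_mem := by
    rintro i j p _ hp ⟨q, hq, rfl⟩
    exact ⟨p • q, polyDegree_mul hp hq, (toFiberCone I).map_smul p q⟩

end Blowup

end FiberReg

end

/-! Two short exact sequences of graded modules tie the three regularities together: `0 → 𝔪R(I) →
R(I) → F(I) → 0`, and `0 → 𝔪R(I)(-1) → R(𝓕) → A → 0`, whose first map is multiplication by `t` and
whose cokernel `A` sits in degree 0 and is killed by `R(I)₊`. The cokernel has only `H⁰`, in degree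
0, so `H^i(𝔪R(I))_n = 0` as soon as `H^i(R(𝓕))_{n+1} = 0`, except possibly for `(i, n) = (1, -1)`
(`vanishes_maximalExt`).

Put `a = reg R(I)`. By hypothesis `H^i(𝔪R(I))_n = 0` whenever `n + i + 1 > a`, apart from the
exceptional pair. The first sequence then gives `H^i(F(I))_n = 0` for `n + i > a`, hence `reg F(I) ≤
a`. If `H^i(R(I))_n ≠ 0` with `n + i = a > 0`, the corresponding piece of `H^i(𝔪R(I))` vanishes, so
the nonzero class survives in `F(I)` and `reg F(I) ≥ a`. If `a = 0`, it is enough that `reg F(I) ≥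
0`.

Two general facts remain. First, `a` is an integer and is attained: `exists_reg_le` bounds it above
by Noetherian induction on cyclic quotients, using that Čech cohomology is torsion
(`exists_smul_mem_cechCoboundaries`). Second, `exists_not_vanishes` gives nonnegative regularity to
a module that vanishes in degree -1 but not in degree 0. This comes from a diagram chase in the
Koszul-Čech double complex on degree-one generators (`exists_koszul_correction`). -/

noncomputable section

namespace FiberReg

/-! ### Sign rules for the Čech and Koszul differentials. -/

section Signs

variable {S : Type*} [CommRing S] {r : ℕ}

/-- The common form of the `d² = 0` arguments: swapping the two removed (or inserted) indices is a
fixed-point-free involution that cancels terms in pairs. -/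
lemma sum_sum_erase_eq_zero {ι X : Type*} [DecidableEq ι] [AddCommGroup X] (s : Finset ι)
    (a : ι → ι → X) (h : ∀ j ∈ s, ∀ k ∈ s, j ≠ k → a j k + a k j = 0) :
    ∑ j ∈ s, ∑ k ∈ s.erase j, a j k = 0 := by
  rw [Finset.sum_sigma']
  refine Finset.sum_involution (fun x _ => ⟨x.2, x.1⟩) ?_ ?_ ?_ ?_
  · rintro ⟨j, k⟩ hx
    simp only [Finset.mem_sigma, Finset.mem_erase] at hx
    exact h j hx.1 k hx.2.2 (Ne.symm hx.2.1)
  · rintro ⟨j, k⟩ hx _ he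
    simp only [Finset.mem_sigma, Finset.mem_erase] at hx
    simp only [Sigma.mk.injEq, heq_eq_eq] at he
    exact hx.2.1 he.1
  · rintro ⟨j, k⟩ hx
    simp only [Finset.mem_sigma, Finset.mem_erase] at hx ⊢
    exact ⟨hx.2.2, Ne.symm hx.2.1, hx.1⟩
  · rintro ⟨j, k⟩ _
    rfl

/-- The sign of `j` relative to `J`. -/
def cechSign (S : Type*) [CommRing S] (j : Fin r) (J : Finset (Fin r)) : S :=
  (-1) ^ (J.filter (· < j)).card

lemma cechSign_mul_self (j : Fin r) (J : Finset (Fin r)) :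
    cechSign S j J * cechSign S j J = 1 := by
  rw [cechSign, ← pow_add, ← two_mul, pow_mul]
  simp

lemma cechSign_erase_self (j : Fin r) (J : Finset (Fin r)) :
    cechSign S j (J.erase j) = cechSign S j J := by
  rw [cechSign, cechSign, Finset.filter_erase, Finset.erase_eq_of_notMem (by simp)]

lemma cechSign_insert_self (j : Fin r) (J : Finset (Fin r)) :
    cechSign S j (insert j J) = cechSign S j J := by
  rw [cechSign, cechSign, Finset.filter_insert, if_neg (lt_irrefl _)]

lemma cechSign_insert_of_lt {j k : Fin r} {J : Finset (Fin r)} (hk : k ∉ J)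
    (h : k < j) : cechSign S j (insert k J) = -cechSign S j J := by
  rw [cechSign, cechSign, Finset.filter_insert, if_pos h,
    Finset.card_insert_of_notMem (by simp [hk]), pow_succ]
  ring

lemma cechSign_insert_of_gt {j k : Fin r} (J : Finset (Fin r)) (h : j < k) :
    cechSign S j (insert k J) = cechSign S j J := by
  rw [cechSign, cechSign, Finset.filter_insert, if_neg (not_lt.mpr h.le)]

/-- Of two distinct indices, the smaller one flips the sign of the larger when inserted, and not
conversely. -/
lemma cechSign_mul_insert {j k : Fin r} {J : Finset (Fin r)} (hj : j ∉ J) (hk : k ∉ J)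
    (h : j ≠ k) :
    cechSign S j J * cechSign S k (insert j J) + cechSign S k J * cechSign S j (insert k J) =
      0 := by
  rcases lt_or_gt_of_ne h with h | h
  · rw [cechSign_insert_of_lt hj h, cechSign_insert_of_gt J h]
    ring
  · rw [cechSign_insert_of_gt J h, cechSign_insert_of_lt hk h]
    ring

lemma cechSign_mul_erase {j k : Fin r} {J : Finset (Fin r)} (hj : j ∈ J) (hk : k ∈ J)
    (h : j ≠ k) :
    cechSign S j J * cechSign S k (J.erase j) + cechSign S k J * cechSign S j (J.erase k) = 0 := by
  set L := (J.erase j).erase k with hL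
  have hjL : j ∉ L := by simp [hL]
  have hkL : k ∉ L := by simp [hL]
  have h1 : J.erase j = insert k L := by
    rw [hL, Finset.insert_erase (Finset.mem_erase.mpr ⟨h.symm, hk⟩)]
  have h2 : J.erase k = insert j L := by
    rw [hL, Finset.erase_right_comm, Finset.insert_erase (Finset.mem_erase.mpr ⟨h, hj⟩)]
  rw [← cechSign_erase_self (S := S) j J, ← cechSign_erase_self (S := S) k J, h1, h2,
    cechSign_insert_self, cechSign_insert_self, mul_comm, add_comm, mul_comm]
  have := cechSign_mul_insert (S := S) hjL hkL h
  linear_combination this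

end Signs

/-! ### Functoriality of the Čech complex. -/

section Localization

variable {S M N Q : Type*} [CommRing S] [AddCommGroup M] [Module S M]
  [AddCommGroup N] [Module S N] [AddCommGroup Q] [Module S Q] {r : ℕ}

lemma cechRes_mk (f : Fin r → S) {J K : Finset (Fin r)} (h : J ⊆ K) (m : M)
    (s : cechMonoid f J) :
    cechRes M f h (LocalizedModule.mk m s) =
      LocalizedModule.mk m ⟨s.1, cechMonoid_mono f h s.2⟩ := by
  have := IsLocalizedModule.liftOfLE_mk' (cechMonoid f J) (cechMonoid f K) (cechMonoid_mono f h)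
    (LocalizedModule.mkLinearMap (cechMonoid f J) M)
    (LocalizedModule.mkLinearMap (cechMonoid f K) M) m s
  rwa [← IsLocalizedModule.mk_eq_mk', ← IsLocalizedModule.mk_eq_mk'] at this

lemma cechRes_trans (f : Fin r → S) {J K L : Finset (Fin r)} (h : J ⊆ K) (h' : K ⊆ L)
    (x : CechLoc M f J) : cechRes M f h' (cechRes M f h x) = cechRes M f (h.trans h') x := by
  induction x using LocalizedModule.induction_on with
  | h m s => simp only [cechRes_mk]

/-- The map of localizations induced by a linear map. -/
def cechLocMap (f : Fin r → S) (J : Finset (Fin r)) (φ : M →ₗ[S] N) :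
    CechLoc M f J →ₗ[S] CechLoc N f J :=
  IsLocalizedModule.map (cechMonoid f J) (LocalizedModule.mkLinearMap (cechMonoid f J) M)
    (LocalizedModule.mkLinearMap (cechMonoid f J) N) φ

@[simp]
lemma cechLocMap_mk (f : Fin r → S) (J : Finset (Fin r)) (φ : M →ₗ[S] N) (m : M)
    (s : cechMonoid f J) :
    cechLocMap f J φ (LocalizedModule.mk m s) = LocalizedModule.mk (φ m) s :=
  IsLocalizedModule.map_LocalizedModules ..

lemma cechLocMap_res (f : Fin r → S) {J K : Finset (Fin r)} (h : J ⊆ K) (φ : M →ₗ[S] N)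
    (x : CechLoc M f J) :
    cechLocMap f K φ (cechRes M f h x) = cechRes N f h (cechLocMap f J φ x) := by
  induction x using LocalizedModule.induction_on with
  | h m s => simp only [cechRes_mk, cechLocMap_mk]

lemma cechLocMap_injective (f : Fin r → S) (J : Finset (Fin r)) {φ : M →ₗ[S] N}
    (hφ : Function.Injective φ) : Function.Injective (cechLocMap f J φ) :=
  IsLocalizedModule.map_injective _ _ _ φ hφ

lemma cechLocMap_exact (f : Fin r → S) (J : Finset (Fin r)) {φ : M →ₗ[S] N} {ψ : N →ₗ[S] Q}
    (h : Function.Exact φ ψ) : Function.Exact (cechLocMap f J φ) (cechLocMap f J ψ) :=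
  LocalizedModule.map_exact _ φ ψ h

lemma cechLocMap_lsmul (f : Fin r → S) (J : Finset (Fin r)) (a : S) (x : CechLoc M f J) :
    cechLocMap f J (LinearMap.lsmul S M a) x = a • x := by
  induction x using LocalizedModule.induction_on with
  | h m s => simp only [cechLocMap_mk, LinearMap.lsmul_apply, LocalizedModule.smul'_mk]

/-- A cochain as a function on all subsets, extended by zero. -/
def extendCochain (f : Fin r → S) {i : ℕ} (z : CechCochain M f i) (J : Finset (Fin r)) :
    CechLoc M f J :=
  if h : J.card = i then z ⟨J, h⟩ else 0

lemma extendCochain_coe (f : Fin r → S) {i : ℕ} (z : CechCochain M f i)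
    (J : {J : Finset (Fin r) // J.card = i}) : extendCochain f z J.1 = z J := by
  rw [extendCochain, dif_pos J.2]

lemma cechD_apply (f : Fin r → S) {i : ℕ} (z : CechCochain M f i)
    (J : {J : Finset (Fin r) // J.card = i + 1}) :
    cechD M f i z J = ∑ j ∈ J.1,
      cechSign S j J.1 •
        cechRes M f (Finset.erase_subset j J.1) (extendCochain f z (J.1.erase j)) := by
  rw [← Finset.sum_coe_sort]
  simp only [cechD, LinearMap.pi_apply, LinearMap.sum_apply]
  refine Finset.sum_congr rfl fun j _ => ?_
  -- The differential is defined with integer signs; the sign rules above live in `S`.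
  have key : ∀ (e : ℕ) (g : CechCochain M f i →ₗ[S] CechLoc M f J.1),
      ((-1 : ℤ) ^ e • g) z = (-1 : S) ^ e • g z := by
    intro e g
    rcases neg_one_pow_eq_or ℤ e with h | h <;> rcases Nat.even_or_odd e with h' | h' <;>
      simp_all
  rw [key, LinearMap.comp_apply, LinearMap.proj_apply, ← extendCochain_coe f z]
  rfl

lemma cechD_cechD (f : Fin r → S) (i : ℕ) (z : CechCochain M f i) :
    cechD M f (i + 1) (cechD M f i z) = 0 := by
  funext J
  rw [cechD_apply]
  let G : Finset (Fin r) → CechLoc M f J.1 := fun K =>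
    if h : K ⊆ J.1 then cechRes M f h (extendCochain f z K) else 0
  have key : ∀ j ∈ J.1, cechSign S j J.1 • cechRes M f (Finset.erase_subset j J.1)
      (extendCochain f (cechD M f i z) (J.1.erase j)) =
      ∑ k ∈ J.1.erase j, (cechSign S j J.1 * cechSign S k (J.1.erase j)) •
        G ((J.1.erase j).erase k) := by
    intro j hj
    have hc : (J.1.erase j).card = i + 1 := by
      rw [Finset.card_erase_of_mem hj, J.2, Nat.add_sub_cancel]
    rw [extendCochain_coe f (cechD M f i z) ⟨J.1.erase j, hc⟩, cechD_apply, map_sum,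
      Finset.smul_sum]
    refine Finset.sum_congr rfl fun k _ => ?_
    have hs : (J.1.erase j).erase k ⊆ J.1 :=
      (Finset.erase_subset _ _).trans (Finset.erase_subset _ _)
    rw [map_smul, cechRes_trans, smul_smul]
    simp only [G]
    rw [dif_pos hs]
  rw [Finset.sum_congr rfl key]
  refine sum_sum_erase_eq_zero _ _ fun j hj k hk hjk => ?_
  rw [Finset.erase_right_comm, ← add_smul, cechSign_mul_erase hj hk hjk, zero_smul]

/-- The map of Čech cochains induced by a linear map. -/
def cechMap (f : Fin r → S) (i : ℕ) (φ : M →ₗ[S] N) : CechCochain M f i →ₗ[S] CechCochain N f i :=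
  LinearMap.pi fun J => (cechLocMap f J.1 φ).comp (LinearMap.proj J)

@[simp]
lemma cechMap_apply (f : Fin r → S) (i : ℕ) (φ : M →ₗ[S] N) (z : CechCochain M f i)
    (J : {J : Finset (Fin r) // J.card = i}) : cechMap f i φ z J = cechLocMap f J.1 φ (z J) := rfl

lemma cechMap_cechD (f : Fin r → S) (i : ℕ) (φ : M →ₗ[S] N) (z : CechCochain M f i) :
    cechMap f (i + 1) φ (cechD M f i z) = cechD N f i (cechMap f i φ z) := by
  have h : ∀ J, extendCochain f (cechMap f i φ z) J = cechLocMap f J φ (extendCochain f z J) := by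
    intro J
    simp only [extendCochain]
    split_ifs <;> simp
  funext J
  rw [cechMap_apply, cechD_apply, cechD_apply, map_sum]
  refine Finset.sum_congr rfl fun j _ => ?_
  rw [map_smul, cechLocMap_res, h]

lemma cechMap_lsmul (f : Fin r → S) (i : ℕ) (a : S) (z : CechCochain M f i) :
    cechMap f i (LinearMap.lsmul S M a) z = a • z := by
  funext J
  rw [cechMap_apply, cechLocMap_lsmul, Pi.smul_apply]

lemma cechMap_injective (f : Fin r → S) (i : ℕ) {φ : M →ₗ[S] N} (h : Function.Injective φ) :
    Function.Injective (cechMap f i φ) := by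
  intro z w e
  funext J
  refine cechLocMap_injective f J.1 h ?_
  rw [← cechMap_apply, ← cechMap_apply, e]

end Localization

/-! ### The long exact sequence of graded Čech cohomology, as vanishing statements. -/

section Exactness

variable {S M N Q : Type*} [CommRing S] [AddCommGroup M] [Module S M]
  [AddCommGroup N] [Module S N] [AddCommGroup Q] [Module S Q] {r : ℕ}

lemma graded_smul_mem {𝒮 : ℤ → AddSubgroup S} {ℳ : ℤ → AddSubgroup M} [SetLike.GradedSMul 𝒮 ℳ]
    {a b : ℤ} {s : S} {m : M} (hs : s ∈ 𝒮 a) (hm : m ∈ ℳ b) : s • m ∈ ℳ (b + a) := by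
  have := SetLike.GradedSMul.smul_mem hs hm
  rwa [vadd_eq_add, add_comm] at this

lemma exists_degree_of_mem_cechMonoid {𝒮 : ℤ → AddSubgroup S} [SetLike.GradedMonoid 𝒮]
    {f : Fin r → S} (hf : ∀ j, ∃ n : ℤ, f j ∈ 𝒮 n) {J : Finset (Fin r)} {s : S}
    (hs : s ∈ cechMonoid f J) : ∃ n : ℤ, s ∈ 𝒮 n := by
  induction hs using Submonoid.closure_induction with
  | mem x hx =>
    obtain ⟨j, -, rfl⟩ := hx
    exact hf j
  | one => exact ⟨0, SetLike.GradedOne.one_mem⟩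
  | mul x y _ _ hx hy =>
    obtain ⟨a, ha⟩ := hx
    obtain ⟨b, hb⟩ := hy
    exact ⟨a + b, SetLike.GradedMul.mul_mem ha hb⟩

variable (𝒮 : ℤ → AddSubgroup S) [SetLike.GradedMonoid 𝒮]
  (𝒩 : ℤ → AddSubgroup N) [SetLike.GradedSMul 𝒮 𝒩]
  (ℳ : ℤ → AddSubgroup M) [SetLike.GradedSMul 𝒮 ℳ]
  (𝒬 : ℤ → AddSubgroup Q) [SetLike.GradedSMul 𝒮 𝒬] (f : Fin r → S)

/-- The homogeneous component of degree `n` of the `i`-th local cohomology module vanishes. -/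
def CechVanishes (i : ℕ) (n : ℤ) : Prop :=
  ∀ z ∈ cechDegree 𝒮 ℳ f i n, cechD M f i z = 0 → z ∈ cechCoboundaries 𝒮 ℳ f i n

lemma nontrivial_localCohomologyDegree_iff (i : ℕ) (n : ℤ) :
    Nontrivial (LocalCohomologyDegree 𝒮 ℳ f i n) ↔ ¬ CechVanishes 𝒮 ℳ f i n := by
  rw [← not_subsingleton_iff_nontrivial, not_iff_not, QuotientAddGroup.subsingleton_iff,
    AddSubgroup.addSubgroupOf_eq_top]
  constructor
  · exact fun h z hz hd => h ⟨hz, hd⟩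
  · exact fun h z hz => h z hz.1 hz.2

/-- A short exact sequence `0 → N(-d) → M → Q → 0` of graded modules. -/
structure GradedExact (d : ℤ) (φ : N →ₗ[S] M) (ψ : M →ₗ[S] Q) : Prop where
  injective : Function.Injective φ
  exact : Function.Exact φ ψ
  mem_iff : ∀ n x, φ x ∈ ℳ (n + d) ↔ x ∈ 𝒩 n
  map_mem : ∀ n, ∀ x ∈ ℳ n, ψ x ∈ 𝒬 n
  exists_lift : ∀ n, ∀ y ∈ 𝒬 n, ∃ x ∈ ℳ n, ψ x = y

variable {𝒮 𝒩 ℳ 𝒬 f}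

lemma smul_mem_cechLocDegree {a : S} {c : ℤ} (ha : a ∈ 𝒮 c) {J : Finset (Fin r)} {n : ℤ}
    {x : CechLoc M f J} (hx : x ∈ cechLocDegree 𝒮 ℳ f J n) :
    a • x ∈ cechLocDegree 𝒮 ℳ f J (n + c) := by
  obtain ⟨e, s, m, hs, hm, rfl⟩ := hx
  refine ⟨e, s, a • m, hs, ?_, LocalizedModule.smul'_mk ..⟩
  have := graded_smul_mem ha hm
  rwa [add_right_comm] at this

lemma cechRes_mem {J K : Finset (Fin r)} (h : J ⊆ K) {n : ℤ}
    {x : CechLoc M f J} (hx : x ∈ cechLocDegree 𝒮 ℳ f J n) :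
    cechRes M f h x ∈ cechLocDegree 𝒮 ℳ f K n := by
  obtain ⟨e, s, m, hs, hm, rfl⟩ := hx
  exact ⟨e, ⟨s.1, cechMonoid_mono f h s.2⟩, m, hs, hm, cechRes_mk f h m s⟩

lemma cechLocMap_mem {d : ℤ} {φ : N →ₗ[S] M} (hφ : ∀ n, ∀ x ∈ 𝒩 n, φ x ∈ ℳ (n + d))
    {J : Finset (Fin r)} {n : ℤ} {x : CechLoc N f J} (hx : x ∈ cechLocDegree 𝒮 𝒩 f J n) :
    cechLocMap f J φ x ∈ cechLocDegree 𝒮 ℳ f J (n + d) := by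
  obtain ⟨e, s, m, hs, hm, rfl⟩ := hx
  refine ⟨e, s, φ m, hs, ?_, cechLocMap_mk ..⟩
  have := hφ _ _ hm
  rwa [add_right_comm] at this

lemma smul_mem_cechDegree {a : S} {c : ℤ} (ha : a ∈ 𝒮 c) {i : ℕ} {n : ℤ}
    {z : CechCochain M f i} (hz : z ∈ cechDegree 𝒮 ℳ f i n) :
    a • z ∈ cechDegree 𝒮 ℳ f i (n + c) :=
  fun J hJ => smul_mem_cechLocDegree ha (hz J hJ)

lemma cechMap_mem {d : ℤ} {φ : N →ₗ[S] M} (hφ : ∀ n, ∀ x ∈ 𝒩 n, φ x ∈ ℳ (n + d))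
    {i : ℕ} {n : ℤ} {z : CechCochain N f i} (hz : z ∈ cechDegree 𝒮 𝒩 f i n) :
    cechMap f i φ z ∈ cechDegree 𝒮 ℳ f i (n + d) :=
  fun J hJ => cechLocMap_mem hφ (hz J hJ)

lemma cechSign_smul_mem {X : Type*} [AddCommGroup X] [Module S X] (H : AddSubgroup X)
    (j : Fin r) (J : Finset (Fin r)) {x : X} (hx : x ∈ H) : cechSign S j J • x ∈ H := by
  rcases neg_one_pow_eq_or S (J.filter (· < j)).card with h | h <;> rw [cechSign, h] <;> simpa

lemma extendCochain_mem {i : ℕ} {n : ℤ} {z : CechCochain M f i}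
    (hz : z ∈ cechDegree 𝒮 ℳ f i n) (J : Finset (Fin r)) :
    extendCochain f z J ∈ cechLocDegree 𝒮 ℳ f J n := by
  rw [extendCochain]
  split_ifs with h
  · exact hz ⟨J, h⟩ trivial
  · exact zero_mem _

lemma cechD_mem {i : ℕ} {n : ℤ} {z : CechCochain M f i} (hz : z ∈ cechDegree 𝒮 ℳ f i n) :
    cechD M f i z ∈ cechDegree 𝒮 ℳ f (i + 1) n := by
  intro J _
  change cechD M f i z J ∈ cechLocDegree 𝒮 ℳ f J.1 n
  rw [cechD_apply]
  exact sum_mem fun j _ => cechSign_smul_mem _ _ _ (cechRes_mem _ (extendCochain_mem hz _))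

lemma cechCoboundaries_le (i : ℕ) (n : ℤ) :
    cechCoboundaries 𝒮 ℳ f i n ≤ cechDegree 𝒮 ℳ f i n := by
  cases i with
  | zero => exact bot_le
  | succ i =>
    rintro _ ⟨z, hz, rfl⟩
    exact cechD_mem hz

lemma cechMap_coboundary {d : ℤ} {φ : N →ₗ[S] M} (hφ : ∀ n, ∀ x ∈ 𝒩 n, φ x ∈ ℳ (n + d))
    {i : ℕ} {n : ℤ} {z : CechCochain N f i} (hz : z ∈ cechCoboundaries 𝒮 𝒩 f i n) :
    cechMap f i φ z ∈ cechCoboundaries 𝒮 ℳ f i (n + d) := by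
  cases i with
  | zero =>
    rw [(AddSubgroup.mem_bot.mp hz : z = 0), map_zero]
    exact zero_mem _
  | succ i =>
    obtain ⟨w, hw, rfl⟩ := hz
    exact ⟨cechMap f i φ w, cechMap_mem hφ hw, (cechMap_cechD f i φ w).symm⟩

namespace GradedExact

variable {d : ℤ} {φ : N →ₗ[S] M} {ψ : M →ₗ[S] Q} (E : GradedExact 𝒩 ℳ 𝒬 d φ ψ)
include E

lemma map_mem_left (n : ℤ) (x : N) (hx : x ∈ 𝒩 n) : φ x ∈ ℳ (n + d) := (E.mem_iff n x).mpr hx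

lemma map_mem_right (n : ℤ) (x : M) (hx : x ∈ ℳ n) : ψ x ∈ 𝒬 (n + 0) := by
  rw [add_zero]
  exact E.map_mem n x hx

lemma comp_eq_zero (i : ℕ) (z : CechCochain N f i) :
    cechMap f i ψ (cechMap f i φ z) = 0 := by
  funext J
  rw [cechMap_apply, cechMap_apply]
  exact (cechLocMap_exact f J.1 E.exact _).mpr ⟨z J, rfl⟩

-- If `m / s` dies under `ψ`, some denominator `t` satisfies `ψ (t m) = 0`, so `t m` comes from `N`
-- and `m / s = t m / (t s)`. Denominators are products of homogeneous elements, which makes the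
-- preimage homogeneous by `mem_iff`.
omit [SetLike.GradedSMul 𝒮 𝒬] in
lemma exists_cechLoc_preimage (hf : ∀ j, ∃ n : ℤ, f j ∈ 𝒮 n) {J : Finset (Fin r)} {n : ℤ}
    {x : CechLoc M f J} (hx : x ∈ cechLocDegree 𝒮 ℳ f J (n + d)) (h : cechLocMap f J ψ x = 0) :
    ∃ y ∈ cechLocDegree 𝒮 𝒩 f J n, cechLocMap f J φ y = x := by
  obtain ⟨e, s, m, hs, hm, rfl⟩ := hx
  rw [cechLocMap_mk, ← LocalizedModule.zero_mk 1, LocalizedModule.mk_eq] at h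
  obtain ⟨t, ht⟩ := h
  rw [one_smul, smul_zero, smul_zero, Submonoid.smul_def, ← map_smul] at ht
  obtain ⟨y, hy⟩ := (E.exact _).mp ht
  obtain ⟨c, hc⟩ := exists_degree_of_mem_cechMonoid hf t.2
  refine ⟨LocalizedModule.mk y (t * s), ⟨c + e, t * s, y, SetLike.GradedMul.mul_mem hc hs, ?_, rfl⟩,
    ?_⟩
  · rw [← E.mem_iff, hy]
    have := graded_smul_mem hc hm
    rwa [show n + d + e + c = n + (c + e) + d by ring] at this
  · rw [cechLocMap_mk, hy]
    exact LocalizedModule.mk_cancel_common_left t s m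

omit [SetLike.GradedSMul 𝒮 𝒬] in
lemma exists_preimage (hf : ∀ j, ∃ n : ℤ, f j ∈ 𝒮 n) {i : ℕ} {n : ℤ}
    {z : CechCochain M f i} (hz : z ∈ cechDegree 𝒮 ℳ f i (n + d)) (h : cechMap f i ψ z = 0) :
    ∃ y ∈ cechDegree 𝒮 𝒩 f i n, cechMap f i φ y = z := by
  choose y hy hyz using fun J => E.exists_cechLoc_preimage hf (hz J trivial) (congrFun h J)
  exact ⟨y, fun J _ => hy J, funext hyz⟩

omit [SetLike.GradedSMul 𝒮 𝒩] in
lemma exists_cechLoc_lift {J : Finset (Fin r)} {n : ℤ}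
    {x : CechLoc Q f J} (hx : x ∈ cechLocDegree 𝒮 𝒬 f J n) :
    ∃ y ∈ cechLocDegree 𝒮 ℳ f J n, cechLocMap f J ψ y = x := by
  obtain ⟨e, s, m, hs, hm, rfl⟩ := hx
  obtain ⟨y, hy, rfl⟩ := E.exists_lift _ _ hm
  exact ⟨_, ⟨e, s, y, hs, hy, rfl⟩, cechLocMap_mk ..⟩

omit [SetLike.GradedSMul 𝒮 𝒩] in
lemma exists_cochain_lift {i : ℕ} {n : ℤ}
    {z : CechCochain Q f i} (hz : z ∈ cechDegree 𝒮 𝒬 f i n) :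
    ∃ y ∈ cechDegree 𝒮 ℳ f i n, cechMap f i ψ y = z := by
  choose y hy hyz using fun J => E.exists_cechLoc_lift (hz J trivial)
  exact ⟨y, fun J _ => hy J, funext hyz⟩

/-- A class of `N` that dies in `M` is zero if the connecting homomorphism vanishes. -/
lemma coboundary_of_map (hf : ∀ j, ∃ n : ℤ, f j ∈ 𝒮 n) {i : ℕ} {n : ℤ}
    (hQ : ∀ j, j + 1 = i → CechVanishes 𝒮 𝒬 f j (n + d)) {z : CechCochain N f i}
    (hz : cechMap f i φ z ∈ cechCoboundaries 𝒮 ℳ f i (n + d)) :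
    z ∈ cechCoboundaries 𝒮 𝒩 f i n := by
  cases i with
  | zero =>
    refine AddSubgroup.mem_bot.mpr (cechMap_injective f 0 E.injective ?_)
    rw [map_zero]
    exact AddSubgroup.mem_bot.mp hz
  | succ i =>
    obtain ⟨w, hw, hwz⟩ := hz
    have hwz : cechD M f i w = cechMap f (i + 1) φ z := hwz
    have h1 : cechD Q f i (cechMap f i ψ w) = 0 := by
      rw [← cechMap_cechD, hwz, E.comp_eq_zero]
    have h2 : cechMap f i ψ w ∈ cechDegree 𝒮 𝒬 f i (n + d) := by
      simpa using cechMap_mem E.map_mem_right hw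
    -- modify `w` by a coboundary so that it comes from `N`
    have h3 : ∃ w' ∈ cechDegree 𝒮 ℳ f i (n + d), cechMap f i ψ w' = 0 ∧
        cechD M f i w' = cechD M f i w := by
      have h4 := hQ i rfl _ h2 h1
      cases i with
      | zero => exact ⟨w, hw, AddSubgroup.mem_bot.mp h4, rfl⟩
      | succ i =>
        obtain ⟨v, hv, hvw⟩ := h4
        have hvw : cechD Q f i v = cechMap f (i + 1) ψ w := hvw
        obtain ⟨u, hu, rfl⟩ := E.exists_cochain_lift hv
        refine ⟨w - cechD M f i u, sub_mem hw (cechD_mem hu), ?_, ?_⟩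
        · rw [map_sub, cechMap_cechD, hvw, sub_self]
        · rw [map_sub, cechD_cechD, sub_zero]
    obtain ⟨w', hw', h5, h6⟩ := h3
    obtain ⟨y, hy, rfl⟩ := E.exists_preimage hf hw' h5
    refine ⟨y, hy, cechMap_injective f _ E.injective ?_⟩
    change cechMap f (i + 1) φ (cechD N f i y) = _
    rw [cechMap_cechD, h6, hwz]

/-- Exactness of `H^{i-1}(Q) → H^i(N) → H^i(M)`; writing the index below `i` as `j + 1 = i` makes
the condition on `Q` empty when `i = 0`. -/
lemma vanishes_left (hf : ∀ j, ∃ n : ℤ, f j ∈ 𝒮 n) {i : ℕ} {n : ℤ}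
    (hM : CechVanishes 𝒮 ℳ f i (n + d))
    (hQ : ∀ j, j + 1 = i → CechVanishes 𝒮 𝒬 f j (n + d)) : CechVanishes 𝒮 𝒩 f i n := by
  intro z hz hdz
  refine E.coboundary_of_map hf hQ (hM _ (cechMap_mem E.map_mem_left hz) ?_)
  rw [← cechMap_cechD, hdz, map_zero]

/-- Exactness of `H^i(N) → H^i(M) → H^i(Q)`: subtracting a lifted coboundary moves the cocycle into
the image of `N`. -/
lemma vanishes_middle (hf : ∀ j, ∃ n : ℤ, f j ∈ 𝒮 n) {i : ℕ} {n : ℤ}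
    (hN : CechVanishes 𝒮 𝒩 f i n) (hQ : CechVanishes 𝒮 𝒬 f i (n + d)) :
    CechVanishes 𝒮 ℳ f i (n + d) := by
  intro z hz hdz
  have h1 : cechMap f i ψ z ∈ cechDegree 𝒮 𝒬 f i (n + d) := by
    simpa using cechMap_mem E.map_mem_right hz
  have h2 := hQ _ h1 (by rw [← cechMap_cechD, hdz, map_zero])
  have h3 : ∃ w ∈ cechCoboundaries 𝒮 ℳ f i (n + d), cechMap f i ψ (z - w) = 0 ∧
      cechD M f i w = 0 := by
    cases i with
    | zero => exact ⟨0, zero_mem _, by rw [sub_zero]; exact AddSubgroup.mem_bot.mp h2, map_zero _⟩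
    | succ i =>
      obtain ⟨v, hv, hvz⟩ := h2
      have hvz : cechD Q f i v = cechMap f (i + 1) ψ z := hvz
      obtain ⟨u, hu, rfl⟩ := E.exists_cochain_lift hv
      refine ⟨cechD M f i u, ⟨u, hu, rfl⟩, ?_, cechD_cechD f i u⟩
      rw [map_sub, cechMap_cechD, hvz, sub_self]
  obtain ⟨w, hw, h4, h5⟩ := h3
  obtain ⟨y, hy, hyz⟩ := E.exists_preimage hf (sub_mem hz (cechCoboundaries_le _ _ hw)) h4
  have h6 : y ∈ cechCoboundaries 𝒮 𝒩 f i n := by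
    refine hN y hy (cechMap_injective f _ E.injective ?_)
    rw [cechMap_cechD, hyz, map_sub, hdz, h5, sub_zero, map_zero]
  have h7 := cechMap_coboundary E.map_mem_left h6
  rw [hyz] at h7
  simpa using add_mem h7 hw

/-- Exactness of `H^i(M) → H^i(Q) → H^{i+1}(N)`: the cochain `y` below represents the connecting
image of `z`. -/
lemma vanishes_right (hf : ∀ j, ∃ n : ℤ, f j ∈ 𝒮 n) {i : ℕ} {n : ℤ}
    (hM : CechVanishes 𝒮 ℳ f i (n + d)) (hN : CechVanishes 𝒮 𝒩 f (i + 1) n) :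
    CechVanishes 𝒮 𝒬 f i (n + d) := by
  intro z hz hdz
  obtain ⟨w, hw, rfl⟩ := E.exists_cochain_lift hz
  obtain ⟨y, hy, hyw⟩ := E.exists_preimage hf (cechD_mem hw) (by rw [cechMap_cechD, hdz])
  have h1 : cechD N f (i + 1) y = 0 := by
    refine cechMap_injective f _ E.injective ?_
    rw [cechMap_cechD, hyw, cechD_cechD, map_zero]
  obtain ⟨v, hv, hvy⟩ := hN y hy h1
  have hvy : cechD N f i v = y := hvy
  have h2 := hM (w - cechMap f i φ v) (sub_mem hw (cechMap_mem E.map_mem_left hv))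
    (by rw [map_sub, ← cechMap_cechD, hvy, hyw, sub_self])
  have h3 := cechMap_coboundary E.map_mem_right h2
  rw [map_sub, E.comp_eq_zero, sub_zero] at h3
  simpa using h3

end GradedExact

end Exactness

/-! ### Čech cohomology is torsion for each of the elements `f k`. -/

section Torsion

variable {S M Q : Type*} [CommRing S] [AddCommGroup M] [Module S M]
  [AddCommGroup Q] [Module S Q] {r : ℕ}
  {𝒮 : ℤ → AddSubgroup S} [SetLike.GradedMonoid 𝒮]
  {ℳ : ℤ → AddSubgroup M} [SetLike.GradedSMul 𝒮 ℳ]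
  {𝒬 : ℤ → AddSubgroup Q} [SetLike.GradedSMul 𝒮 𝒬] {f : Fin r → S}

lemma graded_pow_mem {a : S} {d : ℤ} (ha : a ∈ 𝒮 d) (e : ℕ) : a ^ e ∈ 𝒮 (e * d) := by
  simpa using SetLike.pow_mem_graded e ha

lemma exists_pow_mul_of_mem_cechMonoid_insert {k : Fin r} {J : Finset (Fin r)} {s : S}
    (hs : s ∈ cechMonoid f (insert k J)) :
    ∃ (a : ℕ) (t : S), t ∈ cechMonoid f J ∧ s = f k ^ a * t := by
  rw [cechMonoid, Finset.coe_insert, Set.image_insert_eq, Set.insert_eq, Submonoid.closure_union,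
    Submonoid.mem_sup] at hs
  obtain ⟨y, hy, t, ht, rfl⟩ := hs
  obtain ⟨a, rfl⟩ := Submonoid.mem_closure_singleton.mp hy
  exact ⟨a, t, ht, rfl⟩

lemma eventually_smul_mem_range_cechRes (h𝒮 : ∀ a b, a ≠ b → Disjoint (𝒮 a) (𝒮 b))
    (hf : ∀ j, ∃ n : ℤ, f j ∈ 𝒮 n) {k : Fin r} {d : ℤ} (hk : f k ∈ 𝒮 d) {J : Finset (Fin r)}
    {n : ℤ} {x : CechLoc M f (insert k J)} (hx : x ∈ cechLocDegree 𝒮 ℳ f (insert k J) n) :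
    ∀ᶠ e : ℕ in Filter.atTop, ∃ w ∈ cechLocDegree 𝒮 ℳ f J (n + e * d),
      cechRes M f (Finset.subset_insert k J) w = f k ^ e • x := by
  obtain ⟨c, s, m, hs, hm, rfl⟩ := hx
  obtain ⟨a, t, ht, hst⟩ := exists_pow_mul_of_mem_cechMonoid_insert s.2
  obtain ⟨b, hb⟩ := exists_degree_of_mem_cechMonoid hf ht
  filter_upwards [Filter.eventually_ge_atTop a] with e he
  -- Only the zero element has two degrees, so a mismatch forces the denominator to be 0 and the
  -- localization to vanish.
  by_cases hc : c = a * d + b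
  · refine ⟨LocalizedModule.mk (f k ^ (e - a) • m) ⟨t, ht⟩, ⟨b, ⟨t, ht⟩, _, hb, ?_, rfl⟩, ?_⟩
    · have := graded_smul_mem (graded_pow_mem hk (e - a)) hm
      rwa [hc, Nat.cast_sub he, show n + (a * d + b) + (e - a : ℤ) * d = n + e * d + b by ring]
        at this
    · rw [cechRes_mk, LocalizedModule.smul'_mk, LocalizedModule.mk_eq]
      refine ⟨1, ?_⟩
      simp only [Submonoid.smul_def, hst, smul_smul, Submonoid.coe_one, one_mul]
      congr 1
      calc f k ^ a * t * f k ^ (e - a) = t * (f k ^ a * f k ^ (e - a)) := by ring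
        _ = t * f k ^ e := by rw [← pow_add, Nat.add_sub_cancel' he]
  · have h0 : s.1 = 0 := by
      refine (AddSubgroup.disjoint_def.mp (h𝒮 _ _ hc)) hs ?_
      rw [hst]
      exact SetLike.GradedMul.mul_mem (graded_pow_mem hk a) hb
    have h1 : (LocalizedModule.mk m s : CechLoc M f (insert k J)) = 0 := by
      rw [← LocalizedModule.zero_mk 1, LocalizedModule.mk_eq]
      exact ⟨s, by simp [Submonoid.smul_def, h0]⟩
    exact ⟨0, zero_mem _, by rw [h1, map_zero, smul_zero]⟩

lemma eventually_smul_eq_zero_of_cechRes {k : Fin r} {J : Finset (Fin r)} {x : CechLoc M f J}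
    (hx : cechRes M f (Finset.subset_insert k J) x = 0) :
    ∀ᶠ e : ℕ in Filter.atTop, f k ^ e • x = 0 := by
  induction x using LocalizedModule.induction_on with
  | h m s =>
    rw [cechRes_mk, ← LocalizedModule.zero_mk 1, LocalizedModule.mk_eq] at hx
    obtain ⟨u, hu⟩ := hx
    obtain ⟨a, t, ht, hut⟩ := exists_pow_mul_of_mem_cechMonoid_insert u.2
    filter_upwards [Filter.eventually_ge_atTop a] with e he
    rw [LocalizedModule.smul'_mk, ← LocalizedModule.zero_mk 1, LocalizedModule.mk_eq]
    refine ⟨⟨t, ht⟩, ?_⟩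
    simp only [Submonoid.smul_def, hut, one_smul, smul_zero] at hu ⊢
    rw [smul_smul, ← Nat.sub_add_cancel he, pow_add, mul_left_comm, mul_comm t, mul_smul, hu,
      smul_zero]

lemma cechD_apply_of_support {i : ℕ} {k : Fin r} {y : CechCochain M f i}
    (hy : ∀ J, k ∈ J → extendCochain f y J = 0) (K : {K : Finset (Fin r) // K.card = i + 1})
    (hk : k ∈ K.1) :
    cechD M f i y K = cechSign S k K.1 •
      cechRes M f (Finset.erase_subset k K.1) (extendCochain f y (K.1.erase k)) := by
  rw [cechD_apply]
  refine Finset.sum_eq_single_of_mem k hk fun j _ hjk => ?_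
  rw [hy _ (Finset.mem_erase.mpr ⟨Ne.symm hjk, hk⟩), map_zero, smul_zero]

lemma cechSign_smul_injective {X : Type*} [AddCommGroup X] [Module S X] {j : Fin r}
    {J : Finset (Fin r)} {x : X} (h : cechSign S j J • x = 0) : x = 0 := by
  rw [← one_smul S x, ← cechSign_mul_self j J, mul_smul, h, smul_zero]

/-- For `k ∉ J`, the `insert k J` component of `d y` is, up to sign, just the restriction of `y J`.
Hence each `y J` becomes 0 once `f k` is inverted, and one power of `f k` serves the finitely many
`J`. -/
lemma exists_smul_eq_zero_of_support {i : ℕ} {k : Fin r} {y : CechCochain M f i}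
    (hy : ∀ J, k ∈ J → extendCochain f y J = 0) (hd : cechD M f i y = 0) :
    ∃ e : ℕ, f k ^ e • y = 0 := by
  have key : ∀ J : {J : Finset (Fin r) // J.card = i},
      ∀ᶠ e : ℕ in Filter.atTop, f k ^ e • y J = 0 := by
    intro J
    by_cases hk : k ∈ J.1
    · have := hy J.1 hk
      rw [extendCochain_coe] at this
      simp [this]
    · refine eventually_smul_eq_zero_of_cechRes ?_
      have h1 := cechD_apply_of_support hy
        ⟨insert k J.1, by rw [Finset.card_insert_of_notMem hk, J.2]⟩ (Finset.mem_insert_self k J.1)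
      rw [hd] at h1
      have h2 := cechSign_smul_injective h1.symm
      -- Generalizing the index set allows transport along `(insert k J).erase k = J`.
      have h3 : ∀ L (hL : L ⊆ insert k J.1), L = J.1 →
          cechRes M f hL (extendCochain f y L) = 0 →
          cechRes M f (Finset.subset_insert k J.1) (y J) = 0 := by
        rintro L hL rfl h
        rwa [extendCochain_coe] at h
      exact h3 _ _ (Finset.erase_insert hk) h2
  obtain ⟨e, he⟩ := (Filter.eventually_all.mpr key).exists
  exact ⟨e, funext he⟩

/-- Local cohomology is torsion with respect to each of the elements `f k`. -/
lemma exists_smul_mem_cechCoboundaries (h𝒮 : ∀ a b, a ≠ b → Disjoint (𝒮 a) (𝒮 b))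
    (hf : ∀ j, ∃ n : ℤ, f j ∈ 𝒮 n) {k : Fin r} {d : ℤ} (hk : f k ∈ 𝒮 d) {i : ℕ} {n : ℤ}
    {z : CechCochain M f i} (hz : z ∈ cechDegree 𝒮 ℳ f i n) (hd : cechD M f i z = 0) :
    ∃ e : ℕ, f k ^ e • z ∈ cechCoboundaries 𝒮 ℳ f i (n + e * d) := by
  cases i with
  | zero =>
    obtain ⟨e, he⟩ := exists_smul_eq_zero_of_support (k := k) (y := z) (fun J hJ => by
      rw [extendCochain, dif_neg (Finset.card_ne_zero_of_mem hJ)]) hd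
    exact ⟨e, by rw [he]; exact zero_mem _⟩
  | succ i =>
    have key : ∀ J : Finset (Fin r), ∀ᶠ e : ℕ in Filter.atTop,
        ∃ w ∈ cechLocDegree 𝒮 ℳ f J (n + e * d), ∀ (K : Finset (Fin r)) (hK : J ⊆ K),
          K = insert k J → cechRes M f hK w = f k ^ e • extendCochain f z K := by
      intro J
      filter_upwards [eventually_smul_mem_range_cechRes h𝒮 hf hk
        (extendCochain_mem hz (insert k J))] with e ⟨w, hw, hwe⟩
      refine ⟨w, hw, ?_⟩
      rintro K hK rfl
      exact hwe
    obtain ⟨e, he⟩ := (Filter.eventually_all.mpr key).exists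
    choose w hw hwe using he
    -- A contraction against `k`: `w J` lifts `f k ^ e • z` from the localization at `insert k J`.
    -- The coboundary of `v` agrees with `f k ^ e • z` on all sets containing `k`; the difference is
    -- a cocycle supported away from `k`, hence torsion.
    let v : CechCochain M f i := fun J => if k ∈ J.1 then 0 else cechSign S k J.1 • w J.1
    have hv : v ∈ cechDegree 𝒮 ℳ f i (n + e * d) := by
      intro J _
      change (if k ∈ J.1 then 0 else cechSign S k J.1 • w J.1) ∈ cechLocDegree 𝒮 ℳ f J.1 _
      split_ifs
      · exact zero_mem _
      · exact cechSign_smul_mem _ _ _ (hw J.1)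
    have hv0 : ∀ J, k ∈ J → extendCochain f v J = 0 := by
      intro J hJ
      rw [extendCochain]
      split_ifs
      · exact if_pos hJ
      · rfl
    have hvk : ∀ K : {K : Finset (Fin r) // K.card = i + 1}, k ∈ K.1 →
        cechD M f i v K = f k ^ e • z K := by
      intro K hK
      have hc : (K.1.erase k).card = i := by
        rw [Finset.card_erase_of_mem hK, K.2, Nat.add_sub_cancel]
      have h1 : extendCochain f v (K.1.erase k) =
          cechSign S k (K.1.erase k) • w (K.1.erase k) := by
        rw [extendCochain, dif_pos hc]
        exact if_neg (Finset.notMem_erase k K.1)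
      rw [cechD_apply_of_support hv0 K hK, h1, map_smul, smul_smul, cechSign_erase_self,
        cechSign_mul_self, one_smul, hwe _ _ _ (Finset.insert_erase hK).symm, extendCochain_coe]
    obtain ⟨e', he'⟩ := exists_smul_eq_zero_of_support (k := k)
      (y := f k ^ e • z - cechD M f i v) (fun J hJ => by
        rw [extendCochain]
        split_ifs with hc
        · rw [Pi.sub_apply, Pi.smul_apply, hvk ⟨J, hc⟩ hJ, sub_self]
        · rfl) (by rw [map_sub, map_smul, hd, smul_zero, cechD_cechD, sub_zero])
    refine ⟨e' + e, f k ^ e' • v, ?_, ?_⟩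
    · have := smul_mem_cechDegree (graded_pow_mem hk e') hv
      rwa [show n + e * d + e' * d = n + (e' + e : ℕ) * d by push_cast; ring] at this
    · change cechD M f i (f k ^ e' • v) = _
      rw [map_smul, pow_add, mul_smul]
      rw [smul_sub, sub_eq_zero] at he'
      exact he'.symm

/-- In degrees `≥ N` the vanishing of `H^{i-1}(Q)` makes multiplication by `f k` injective on
`H^i(M)`, while every class is killed by a power of `f k`. -/
lemma vanishes_of_exact_smul (h𝒮 : ∀ a b, a ≠ b → Disjoint (𝒮 a) (𝒮 b))
    (hf : ∀ j, ∃ n : ℤ, f j ∈ 𝒮 n) {k : Fin r} {d : ℤ} (hd : 0 ≤ d) (hk : f k ∈ 𝒮 d)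
    {ψ : M →ₗ[S] Q} (E : GradedExact ℳ ℳ 𝒬 d (LinearMap.lsmul S M (f k)) ψ) {i : ℕ} {N : ℤ}
    (hQ : ∀ j, j + 1 = i → ∀ n, N ≤ n → CechVanishes 𝒮 𝒬 f j n) (n : ℤ) (hn : N ≤ n) :
    CechVanishes 𝒮 ℳ f i n := by
  have key : ∀ (e : ℕ) (n : ℤ) (z : CechCochain M f i), N ≤ n →
      f k ^ e • z ∈ cechCoboundaries 𝒮 ℳ f i (n + e * d) → z ∈ cechCoboundaries 𝒮 ℳ f i n := by
    intro e
    induction e with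
    | zero => simp
    | succ e ih =>
      intro n z hn hz
      refine E.coboundary_of_map hf (fun j hj => hQ j hj _ (by omega)) ?_
      rw [cechMap_lsmul]
      refine ih _ _ (by omega) ?_
      rwa [smul_smul, ← pow_succ, show n + d + e * d = n + (e + 1 : ℕ) * d by push_cast; ring]
  intro z hz hdz
  obtain ⟨e, he⟩ := exists_smul_mem_cechCoboundaries h𝒮 hf hk hz hdz
  exact key e n z hn he

/-- A nonempty set of inverted elements already contains one acting as 0, so all cochains of
positive Čech degree are 0. -/
lemma vanishes_succ_of_smul_eq_zero (h : ∀ j (m : M), f j • m = 0) (i : ℕ) (n : ℤ) :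
    CechVanishes 𝒮 ℳ f (i + 1) n := by
  intro z _ _
  have : z = 0 := by
    funext J
    obtain ⟨j, hj⟩ : J.1.Nonempty := Finset.card_pos.mp (by rw [J.2]; exact Nat.succ_pos i)
    rw [Pi.zero_apply]
    induction z J using LocalizedModule.induction_on with
    | h m s =>
      rw [← LocalizedModule.zero_mk 1, LocalizedModule.mk_eq]
      refine ⟨⟨f j, Submonoid.subset_closure ⟨j, hj, rfl⟩⟩, ?_⟩
      simp only [Submonoid.smul_def, one_smul, smul_zero, h]
  rw [this]
  exact zero_mem _

lemma eq_zero_of_mem_cechDegree_zero (h𝒮 : ∀ a b, a ≠ b → Disjoint (𝒮 a) (𝒮 b)) {n : ℤ}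
    (h : ∀ m ∈ ℳ n, m = 0) {z : CechCochain M f 0} (hz : z ∈ cechDegree 𝒮 ℳ f 0 n) : z = 0 := by
  funext J
  obtain ⟨c, s, m, hs, hm, hzJ⟩ := hz J trivial
  have hJ : J.1 = ∅ := Finset.card_eq_zero.mp J.2
  have hs1 : s.1 = 1 := by
    have : s.1 ∈ Submonoid.closure (f '' ((∅ : Finset (Fin r)) : Set (Fin r))) := hJ ▸ s.2
    simpa using this
  rw [hzJ, Pi.zero_apply, ← LocalizedModule.zero_mk 1, LocalizedModule.mk_eq]
  refine ⟨1, ?_⟩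
  simp only [one_smul, smul_zero]
  by_cases hc : c = 0
  · exact h m (by simpa [hc] using hm)
  · have h1 : (1 : S) = 0 := (AddSubgroup.disjoint_def.mp (h𝒮 _ _ hc)) (hs1 ▸ hs)
      SetLike.GradedOne.one_mem
    rw [← one_smul S m, h1, zero_smul]

lemma vanishes_zero_of_degree_eq_bot (h𝒮 : ∀ a b, a ≠ b → Disjoint (𝒮 a) (𝒮 b)) (n : ℤ)
    (h : ∀ m ∈ ℳ n, m = 0) : CechVanishes 𝒮 ℳ f 0 n := by
  intro z hz _
  rw [eq_zero_of_mem_cechDegree_zero h𝒮 h hz]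
  exact zero_mem _

end Torsion

/-! ### Regularity in terms of vanishing. -/

section Regularity

variable {S M : Type*} [CommRing S] [AddCommGroup M] [Module S M] {r : ℕ}
  (𝒮 : ℤ → AddSubgroup S) [SetLike.GradedMonoid 𝒮]
  (ℳ : ℤ → AddSubgroup M) [SetLike.GradedSMul 𝒮 ℳ] (f : Fin r → S)

variable {𝒮 ℳ f} in
lemma le_reg {i : ℕ} {n : ℤ} (h : ¬ CechVanishes 𝒮 ℳ f i n) :
    (((n + i : ℤ) : ℝ) : EReal) ≤ reg 𝒮 ℳ f := by
  have h1 : ((n : ℝ) : EReal) ≤ aInvariant 𝒮 ℳ f i :=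
    le_iSup₂_of_le n ((nontrivial_localCohomologyDegree_iff 𝒮 ℳ f i n).mpr h) le_rfl
  refine le_trans ?_ (le_iSup (fun i : ℕ => aInvariant 𝒮 ℳ f i + (i : EReal)) i)
  rw [Int.cast_add, EReal.coe_add]
  exact add_le_add h1 le_rfl

lemma reg_le_iff (a : ℤ) :
    reg 𝒮 ℳ f ≤ ((a : ℝ) : EReal) ↔ ∀ (i : ℕ) (n : ℤ), a < n + i → CechVanishes 𝒮 ℳ f i n := by
  constructor
  · intro h i n hn
    by_contra hv
    have := (le_reg hv).trans h
    rw [EReal.coe_le_coe_iff, Int.cast_le] at this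
    omega
  · intro h
    refine iSup_le fun i => ?_
    have h1 : aInvariant 𝒮 ℳ f i ≤ (((a - i : ℤ) : ℝ) : EReal) := by
      refine iSup₂_le fun n hn => ?_
      rw [nontrivial_localCohomologyDegree_iff] at hn
      rw [EReal.coe_le_coe_iff, Int.cast_le]
      by_contra hlt
      exact hn (h i n (by omega))
    refine (add_le_add h1 le_rfl).trans (le_of_eq ?_)
    have : ((i : ℕ) : EReal) = ((i : ℝ) : EReal) := rfl
    rw [this, ← EReal.coe_add, Int.cast_sub, Int.cast_natCast, sub_add_cancel]

/-- The regularity is attained as soon as it is bounded on both sides. -/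
lemma exists_reg_eq {b : ℤ} (hb : reg 𝒮 ℳ f ≤ ((b : ℝ) : EReal)) {i₀ : ℕ} {n₀ : ℤ}
    (h₀ : ¬ CechVanishes 𝒮 ℳ f i₀ n₀) :
    ∃ (i : ℕ) (n : ℤ), ¬ CechVanishes 𝒮 ℳ f i n ∧ reg 𝒮 ℳ f = (((n + i : ℤ) : ℝ) : EReal) := by
  obtain ⟨a, ⟨i, n, hv, rfl⟩, ha⟩ := Int.exists_greatest_of_bdd
    (P := fun a : ℤ => ∃ (i : ℕ) (n : ℤ), ¬ CechVanishes 𝒮 ℳ f i n ∧ n + i = a)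
    ⟨b, by
      rintro _ ⟨i, n, hv, rfl⟩
      by_contra hlt
      exact hv ((reg_le_iff 𝒮 ℳ f b).mp hb i n (by omega))⟩ ⟨_, i₀, n₀, h₀, rfl⟩
  refine ⟨i, n, hv, le_antisymm ?_ (le_reg hv)⟩
  rw [reg_le_iff]
  intro j m hlt
  by_contra hv'
  have := ha _ ⟨j, m, hv', rfl⟩
  omega

lemma vanishes_of_lt {i : ℕ} (hi : r < i) (n : ℤ) : CechVanishes 𝒮 ℳ f i n := by
  intro z _ _
  have : z = 0 := by
    funext J
    have := J.2 ▸ Finset.card_le_univ J.1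
    rw [Fintype.card_fin] at this
    omega
  rw [this]
  exact zero_mem _

end Regularity

/-! ### Regularity of a Noetherian graded ring is bounded above. -/

section Finiteness

variable {S : Type*} [CommRing S] {r : ℕ}

/-- The projections of a graded ring onto its homogeneous components. -/
structure IsGradedProjection (𝒮 : ℤ → AddSubgroup S) (π : ℤ → S →+ S) : Prop where
  mem : ∀ n s, π n s ∈ 𝒮 n
  of_mem : ∀ n, ∀ s ∈ 𝒮 n, π n s = s
  of_mem_ne : ∀ m n, m ≠ n → ∀ s ∈ 𝒮 m, π n s = 0
  mul : ∀ d, ∀ s ∈ 𝒮 d, ∀ n t, π (n + d) (s * t) = s * π n t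

variable (𝒮 : ℤ → AddSubgroup S) [SetLike.GradedMonoid 𝒮]

lemma IsGradedProjection.disjoint {𝒮 : ℤ → AddSubgroup S} {π : ℤ → S →+ S}
    (hπ : IsGradedProjection 𝒮 π) (a b : ℤ) (h : a ≠ b) : Disjoint (𝒮 a) (𝒮 b) :=
  AddSubgroup.disjoint_def.mpr fun {s} ha hb => by
    rw [← hπ.of_mem a s ha, hπ.of_mem_ne b a h.symm s hb]

/-- The grading of a quotient of a graded module. -/
def quotientDegree {M : Type*} [AddCommGroup M] [Module S M] (ℳ : ℤ → AddSubgroup M)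
    (L : Submodule S M) (n : ℤ) : AddSubgroup (M ⧸ L) :=
  (ℳ n).map L.mkQ.toAddMonoidHom

omit [SetLike.GradedMonoid 𝒮] in
instance {M : Type*} [AddCommGroup M] [Module S M] (ℳ : ℤ → AddSubgroup M)
    [SetLike.GradedSMul 𝒮 ℳ] (L : Submodule S M) :
    SetLike.GradedSMul 𝒮 (quotientDegree ℳ L) where
  smul_mem := by
    rintro i j p _ hp ⟨q, hq, rfl⟩
    exact ⟨p • q, SetLike.GradedSMul.smul_mem hp hq, L.mkQ.map_smul p q⟩

variable {𝒮}

/-- If `N(-d) → M` is injective with cokernel killed by the `f j`, then local cohomology of `M`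
controls that of `N`. -/
lemma vanishes_of_smul_mem_range {N M : Type*} [AddCommGroup N] [Module S N] [AddCommGroup M]
    [Module S M] {𝒩 : ℤ → AddSubgroup N} [SetLike.GradedSMul 𝒮 𝒩] {ℳ : ℤ → AddSubgroup M}
    [SetLike.GradedSMul 𝒮 ℳ] {f : Fin r → S} (h𝒮 : ∀ a b, a ≠ b → Disjoint (𝒮 a) (𝒮 b))
    (hf : ∀ j, ∃ n : ℤ, f j ∈ 𝒮 n) {φ : N →ₗ[S] M} (hφ : Function.Injective φ) {d : ℤ}
    (hd : ∀ n x, φ x ∈ ℳ (n + d) ↔ x ∈ 𝒩 n) (hfφ : ∀ j m, f j • m ∈ LinearMap.range φ)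
    {i : ℕ} {n : ℤ} (h0 : i = 1 → ∀ m ∈ ℳ (n + d), m ∈ LinearMap.range φ)
    (hM : CechVanishes 𝒮 ℳ f i (n + d)) : CechVanishes 𝒮 𝒩 f i n := by
  have E : GradedExact 𝒩 ℳ (quotientDegree ℳ (LinearMap.range φ)) d φ
      (LinearMap.range φ).mkQ :=
    { injective := hφ
      exact := fun x => by
        rw [Submodule.mkQ_apply, Submodule.Quotient.mk_eq_zero]
        rfl
      mem_iff := hd
      map_mem := fun n x hx => ⟨x, hx, rfl⟩
      exists_lift := fun n y hy => hy }
  refine E.vanishes_left hf hM ?_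
  rintro (_ | j) hj
  · refine vanishes_zero_of_degree_eq_bot h𝒮 _ ?_
    rintro _ ⟨x, hx, rfl⟩
    exact (Submodule.Quotient.mk_eq_zero _).mpr (h0 hj.symm x hx)
  · refine vanishes_succ_of_smul_eq_zero (fun k q => ?_) j _
    obtain ⟨x, rfl⟩ := Submodule.mkQ_surjective _ q
    rw [← map_smul]
    exact (Submodule.Quotient.mk_eq_zero _).mpr (hfφ k x)

/-- The sequence `0 → S/(𝔞 : a)(-d) → S/𝔞 → S/(𝔞 + (a)) → 0` for a homogeneous ideal `𝔞`, which
drives the Noetherian induction. -/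
lemma gradedExact_quotient {π : ℤ → S →+ S} (hπ : IsGradedProjection 𝒮 π) {a : S} {d : ℤ}
    (ha : a ∈ 𝒮 d) {𝔞 𝔠 : Submodule S S} (h𝔞 : ∀ n, ∀ s ∈ 𝔞, π n s ∈ 𝔞)
    (h : 𝔠 = 𝔞.comap (LinearMap.lsmul S S a)) :
    GradedExact (quotientDegree 𝒮 𝔠) (quotientDegree 𝒮 𝔞)
      (quotientDegree 𝒮 (𝔞 ⊔ Submodule.span S {a})) d
      (Submodule.mapQ 𝔠 𝔞 (LinearMap.lsmul S S a) h.le)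
      (Submodule.mapQ 𝔞 (𝔞 ⊔ Submodule.span S {a}) LinearMap.id le_sup_left) := by
  have hinj : Function.Injective (Submodule.mapQ 𝔠 𝔞 (LinearMap.lsmul S S a) h.le) := by
    rw [← LinearMap.ker_eq_bot, LinearMap.ker_eq_bot']
    intro x hx
    obtain ⟨s, rfl⟩ := 𝔠.mkQ_surjective x
    rw [Submodule.mkQ_apply, Submodule.mapQ_apply, Submodule.Quotient.mk_eq_zero] at hx
    rw [Submodule.mkQ_apply, Submodule.Quotient.mk_eq_zero, h]
    exact hx
  refine ⟨hinj, ?_, ?_, ?_, ?_⟩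
  · intro x
    obtain ⟨s, rfl⟩ := 𝔞.mkQ_surjective x
    rw [Submodule.mkQ_apply, Submodule.mapQ_apply, Submodule.Quotient.mk_eq_zero,
      LinearMap.id_apply, Submodule.mem_sup]
    constructor
    · rintro ⟨y, hy, z, hz, rfl⟩
      obtain ⟨t, rfl⟩ := Submodule.mem_span_singleton.mp hz
      refine ⟨𝔠.mkQ t, ?_⟩
      rw [Submodule.mkQ_apply, Submodule.mapQ_apply, Submodule.Quotient.mk_add,
        (Submodule.Quotient.mk_eq_zero 𝔞).mpr hy, zero_add, LinearMap.lsmul_apply, smul_eq_mul,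
        smul_eq_mul, mul_comm]
    · rintro ⟨y, hy⟩
      obtain ⟨t, rfl⟩ := 𝔠.mkQ_surjective y
      rw [Submodule.mkQ_apply, Submodule.mapQ_apply, Submodule.Quotient.eq] at hy
      refine ⟨-(a * t - s), neg_mem hy, a * t, ?_, by ring⟩
      exact Submodule.mem_span_singleton.mpr ⟨t, mul_comm _ _⟩
  · intro n x
    obtain ⟨t, rfl⟩ := 𝔠.mkQ_surjective x
    constructor
    · rintro ⟨s, hs, hst⟩
      have h1 : s - a * t ∈ 𝔞 := (Submodule.Quotient.eq 𝔞).mp hst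
      have h2 := h𝔞 (n + d) _ h1
      rw [map_sub, hπ.of_mem _ _ hs, hπ.mul d a ha] at h2
      -- The representative `t` need not be homogeneous; as `𝔞` is, its component of degree `n` has
      -- the same image.
      refine ⟨π n t, hπ.mem n t, hinj ?_⟩
      refine Eq.trans ?_ hst
      refine ((Submodule.Quotient.eq 𝔞).mpr h2).symm
    · rintro ⟨s, hs, hst⟩
      have hst : 𝔠.mkQ s = 𝔠.mkQ t := hst
      rw [← hst]
      refine ⟨a * s, ?_, rfl⟩
      have := graded_smul_mem ha hs
      exact this
  · rintro n _ ⟨s, hs, rfl⟩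
    exact ⟨s, hs, rfl⟩
  · rintro n _ ⟨s, hs, rfl⟩
    exact ⟨𝔞.mkQ s, ⟨s, hs, rfl⟩, rfl⟩

/-- Local cohomology of a cyclic graded module vanishes in large degrees. -/
lemma exists_vanishes_quotient [IsNoetherianRing S] {π : ℤ → S →+ S}
    (hπ : IsGradedProjection 𝒮 π) {f : Fin r → S} (hf : ∀ j, ∃ n : ℤ, 0 < n ∧ f j ∈ 𝒮 n)
    (h𝒮 : ∀ n, 0 < n → ∀ s ∈ 𝒮 n, s ∈ Ideal.span (Set.range f)) (𝔞 : Submodule S S)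
    (h𝔞 : ∀ n, ∀ s ∈ 𝔞, π n s ∈ 𝔞) (i : ℕ) :
    ∃ N : ℤ, ∀ n, N ≤ n → CechVanishes 𝒮 (quotientDegree 𝒮 𝔞) f i n := by
  have hf' : ∀ j, ∃ n : ℤ, f j ∈ 𝒮 n := fun j => (hf j).imp fun _ h => h.2
  revert i
  induction 𝔞 using WellFoundedGT.induction with
  | ind 𝔞 ih =>
    intro i
    by_cases hall : ∀ j, f j ∈ 𝔞
    -- Here the quotient is killed by all `f j` and vanishes in positive degrees.
    · cases i with
      | zero =>
        refine ⟨1, fun n hn => vanishes_zero_of_degree_eq_bot hπ.disjoint n ?_⟩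
        rintro _ ⟨s, hs, rfl⟩
        refine (Submodule.Quotient.mk_eq_zero 𝔞).mpr ?_
        have : Ideal.span (Set.range f) ≤ 𝔞 := by
          rw [Ideal.span_le]
          rintro _ ⟨j, rfl⟩
          exact hall j
        exact this (h𝒮 n (by omega) s hs)
      | succ i =>
        refine ⟨0, fun n _ => vanishes_succ_of_smul_eq_zero ?_ i n⟩
        intro j m
        obtain ⟨s, rfl⟩ := 𝔞.mkQ_surjective m
        rw [← map_smul]
        refine (Submodule.Quotient.mk_eq_zero 𝔞).mpr ?_
        rw [smul_eq_mul, mul_comm]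
        exact 𝔞.smul_mem s (hall j)
    · push Not at hall
      obtain ⟨k, hk⟩ := hall
      obtain ⟨d, hd, hkd⟩ := hf k
      set 𝔟 := 𝔞 ⊔ Submodule.span S {f k} with h𝔟
      have hlt : 𝔞 < 𝔟 := by
        refine lt_of_le_of_ne le_sup_left fun h => hk ?_
        rw [h, h𝔟]
        exact Submodule.mem_sup_right (Submodule.mem_span_singleton_self _)
      have h1 := ih 𝔟 hlt (by
        intro n s hs
        obtain ⟨y, hy, z, hz, rfl⟩ := Submodule.mem_sup.mp hs
        obtain ⟨t, rfl⟩ := Submodule.mem_span_singleton.mp hz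
        rw [map_add, smul_eq_mul, mul_comm, show n = n - d + d by ring, hπ.mul d _ hkd]
        refine Submodule.add_mem_sup (h𝔞 _ _ hy) ?_
        exact Submodule.mem_span_singleton.mpr ⟨_, mul_comm _ _⟩)
      set 𝔠 := 𝔞.comap (LinearMap.lsmul S S (f k)) with h𝔠
      have hle : 𝔞 ≤ 𝔠 := fun s hs => 𝔞.smul_mem (f k) hs
      -- Either `f k` is a nonzerodivisor on `S/𝔞` and the torsion argument applies, or `(𝔞 : f k)`
      -- is strictly larger and both ends of the sequence fall under the induction.
      rcases hle.eq_or_lt with heq | hlt'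
      · have E := gradedExact_quotient hπ hkd h𝔞 (𝔠 := 𝔞) heq
        have hmap : Submodule.mapQ 𝔞 𝔞 (LinearMap.lsmul S S (f k)) heq.le =
            LinearMap.lsmul S (S ⧸ 𝔞) (f k) := by
          ext
          rfl
        rw [hmap] at E
        cases i with
        | zero =>
          exact ⟨0, vanishes_of_exact_smul hπ.disjoint hf' hd.le hkd E (by omega)⟩
        | succ i =>
          obtain ⟨N, hN⟩ := h1 i
          refine ⟨N, vanishes_of_exact_smul hπ.disjoint hf' hd.le hkd E fun j hj => ?_⟩
          obtain rfl : j = i := by omega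
          exact hN
      · obtain ⟨N, hN⟩ := h1 i
        obtain ⟨N', hN'⟩ := ih 𝔠 hlt' (by
          intro n s hs
          have := h𝔞 (n + d) _ hs
          rw [LinearMap.lsmul_apply, smul_eq_mul, hπ.mul d _ hkd] at this
          exact this) i
        have E := gradedExact_quotient hπ hkd h𝔞 h𝔠
        refine ⟨max N (N' + d), fun n hn => ?_⟩
        have := E.vanishes_middle hf' (hN' (n - d) (by omega)) (hN (n - d + d) (by omega))
        rwa [sub_add_cancel] at this

/-- The regularity of a graded Noetherian ring is not `∞`. -/
lemma exists_reg_le [IsNoetherianRing S] {π : ℤ → S →+ S}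
    (hπ : IsGradedProjection 𝒮 π) {f : Fin r → S} (hf : ∀ j, ∃ n : ℤ, 0 < n ∧ f j ∈ 𝒮 n)
    (h𝒮 : ∀ n, 0 < n → ∀ s ∈ 𝒮 n, s ∈ Ideal.span (Set.range f)) :
    ∃ b : ℤ, reg 𝒮 𝒮 f ≤ ((b : ℝ) : EReal) := by
  have hf' : ∀ j, ∃ n : ℤ, f j ∈ 𝒮 n := fun j => (hf j).imp fun _ h => h.2
  have E : GradedExact 𝒮 (quotientDegree 𝒮 ⊥) (quotientDegree 𝒮 ⊤) 0
      (Submodule.mkQ (⊥ : Submodule S S)) (Submodule.mapQ ⊥ ⊤ LinearMap.id bot_le) := by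
    have hinj : Function.Injective (Submodule.mkQ (⊥ : Submodule S S)) := by
      rw [← LinearMap.ker_eq_bot, Submodule.ker_mkQ]
    have hsub : Subsingleton (S ⧸ (⊤ : Submodule S S)) :=
      Submodule.Quotient.subsingleton_iff.mpr rfl
    refine ⟨hinj, ?_, ?_, ?_, ?_⟩
    · intro x
      exact ⟨fun _ => Submodule.mkQ_surjective _ x, fun _ => Subsingleton.elim _ _⟩
    · intro n x
      rw [add_zero]
      refine ⟨?_, fun hx => ⟨x, hx, rfl⟩⟩
      rintro ⟨y, hy, hxy⟩
      rwa [← hinj hxy]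
    · rintro n _ ⟨s, hs, rfl⟩
      exact ⟨s, hs, rfl⟩
    · intro n y _
      exact ⟨0, zero_mem _, Subsingleton.elim _ _⟩
  choose N hN using exists_vanishes_quotient hπ hf h𝒮 ⊥ (by
    intro n s hs
    rw [(Submodule.mem_bot S).mp hs, map_zero]
    exact zero_mem _)
  have hQ : ∀ i n, CechVanishes 𝒮 (quotientDegree 𝒮 (⊤ : Submodule S S)) f i n := by
    have hsub : Subsingleton (S ⧸ (⊤ : Submodule S S)) :=
      Submodule.Quotient.subsingleton_iff.mpr rfl
    rintro (_ | i) n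
    · exact vanishes_zero_of_degree_eq_bot hπ.disjoint n fun _ _ => Subsingleton.elim _ _
    · exact vanishes_succ_of_smul_eq_zero (fun _ _ => Subsingleton.elim _ _) i n
  obtain ⟨B, hB⟩ := ((Finset.range (r + 1)).image N).exists_le
  -- Only `i ≤ r` matters, and then `n + i > B + r` forces `n > B ≥ N i`.
  refine ⟨B + r, (reg_le_iff 𝒮 𝒮 f _).mpr fun i n hn => ?_⟩
  rcases lt_or_ge r i with hi | hi
  · exact vanishes_of_lt 𝒮 𝒮 f hi n
  · have := hB (N i) (Finset.mem_image_of_mem N (Finset.mem_range.mpr (by omega)))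
    exact E.vanishes_left hf' (hN i _ (by omega)) fun j _ => hQ j _

end Finiteness

/-! ### The Koszul complex and its contracting homotopy. -/

section Koszul

variable {S X Y : Type*} [CommRing S] [AddCommGroup X] [Module S X] [AddCommGroup Y] [Module S Y]
  {s : ℕ}

variable (X) in
/-- The Koszul differential on functions on subsets. -/
def koszulD (g : Fin s → S) : (Finset (Fin s) → X) →ₗ[S] (Finset (Fin s) → X) :=
  LinearMap.pi fun P => ∑ p ∈ Pᶜ, (cechSign S p P * g p) • LinearMap.proj (insert p P)

variable (X) in
/-- Exterior multiplication by `c`, a contracting homotopy of the Koszul complex. -/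
def koszulH (c : Fin s → S) : (Finset (Fin s) → X) →ₗ[S] (Finset (Fin s) → X) :=
  LinearMap.pi fun P => ∑ p ∈ P, (cechSign S p P * c p) • LinearMap.proj (P.erase p)

lemma koszulD_apply (g : Fin s → S) (z : Finset (Fin s) → X) (P : Finset (Fin s)) :
    koszulD X g z P = ∑ p ∈ Pᶜ, (cechSign S p P * g p) • z (insert p P) := by
  simp [koszulD]

lemma koszulH_apply (c : Fin s → S) (z : Finset (Fin s) → X) (P : Finset (Fin s)) :
    koszulH X c z P = ∑ p ∈ P, (cechSign S p P * c p) • z (P.erase p) := by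
  simp [koszulH]

lemma koszulD_koszulD (g : Fin s → S) (z : Finset (Fin s) → X) :
    koszulD X g (koszulD X g z) = 0 := by
  funext P
  rw [koszulD_apply]
  have key : ∀ p ∈ Pᶜ, (cechSign S p P * g p) • koszulD X g z (insert p P) =
      ∑ q ∈ Pᶜ.erase p, (cechSign S p P * cechSign S q (insert p P)) •
        ((g p * g q) • z (insert q (insert p P))) := by
    intro p _
    rw [koszulD_apply, Finset.smul_sum, Finset.compl_insert]
    refine Finset.sum_congr rfl fun q _ => ?_
    rw [smul_smul, smul_smul]
    congr 1
    ring
  rw [Finset.sum_congr rfl key]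
  refine sum_sum_erase_eq_zero _ _ fun p hp q hq hpq => ?_
  rw [Finset.insert_comm, mul_comm (g q), ← add_smul,
    cechSign_mul_insert (Finset.mem_compl.mp hp) (Finset.mem_compl.mp hq) hpq, zero_smul]

lemma cechSign_mul_insert_erase {p q : Fin s} {P : Finset (Fin s)} (hp : p ∉ P) (hq : q ∈ P) :
    cechSign S p P * cechSign S q (insert p P) + cechSign S q P * cechSign S p (P.erase q) = 0 := by
  have hpq : p ≠ q := fun h => hp (h ▸ hq)
  obtain ⟨L, hL⟩ : ∃ L, L = P.erase q := ⟨_, rfl⟩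
  rw [← hL]
  have hpL : p ∉ L := fun h => hp (Finset.mem_of_mem_erase (hL ▸ h))
  have hqL : q ∉ L := hL ▸ Finset.notMem_erase q P
  obtain rfl : P = insert q L := by rw [hL, Finset.insert_erase hq]
  rw [Finset.insert_comm, cechSign_insert_self, cechSign_insert_self]
  rcases lt_or_gt_of_ne hpq with h | h
  · rw [cechSign_insert_of_gt L h, cechSign_insert_of_lt hpL h]
    ring
  · rw [cechSign_insert_of_lt hqL h, cechSign_insert_of_gt L h]
    ring

lemma koszul_homotopy (g c : Fin s → S) (z : Finset (Fin s) → X) :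
    koszulD X g (koszulH X c z) + koszulH X c (koszulD X g z) = (∑ p, c p * g p) • z := by
  funext P
  have h1 : koszulD X g (koszulH X c z) P = ∑ p ∈ Pᶜ, ((c p * g p) • z P +
      ∑ q ∈ P, (cechSign S p P * cechSign S q (insert p P) * (g p * c q)) •
        z (insert p (P.erase q))) := by
    rw [koszulD_apply]
    refine Finset.sum_congr rfl fun p hp => ?_
    have hp : p ∉ P := Finset.mem_compl.mp hp
    rw [koszulH_apply, Finset.sum_insert hp, smul_add, Finset.erase_insert hp, smul_smul,
      cechSign_insert_self, Finset.smul_sum]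
    congr 1
    · congr 1
      linear_combination (c p * g p) * cechSign_mul_self (S := S) p P
    · refine Finset.sum_congr rfl fun q hq => ?_
      rw [smul_smul, Finset.erase_insert_of_ne (by rintro rfl; exact hp hq)]
      congr 1
      ring
  have h2 : koszulH X c (koszulD X g z) P = ∑ q ∈ P, ((c q * g q) • z P +
      ∑ p ∈ Pᶜ, (cechSign S q P * cechSign S p (P.erase q) * (g p * c q)) •
        z (insert p (P.erase q))) := by
    rw [koszulH_apply]
    refine Finset.sum_congr rfl fun q hq => ?_
    rw [koszulD_apply, Finset.compl_erase, Finset.sum_insert (by simpa using hq), smul_add,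
      Finset.insert_erase hq, smul_smul, cechSign_erase_self, Finset.smul_sum]
    congr 1
    · congr 1
      linear_combination (c q * g q) * cechSign_mul_self (S := S) q P
    · refine Finset.sum_congr rfl fun p _ => ?_
      rw [smul_smul]
      congr 1
      ring
  rw [Pi.add_apply, h1, h2, Finset.sum_add_distrib, Finset.sum_add_distrib, Pi.smul_apply,
    Finset.sum_comm (s := P), add_add_add_comm, ← Finset.sum_add_distrib, Finset.sum_smul,
    ← Finset.sum_compl_add_sum P]
  convert add_zero _
  refine Finset.sum_eq_zero fun p hp => ?_
  rw [← Finset.sum_add_distrib]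
  refine Finset.sum_eq_zero fun q hq => ?_
  rw [← add_smul, ← add_mul, cechSign_mul_insert_erase (Finset.mem_compl.mp hp) hq, zero_mul,
    zero_smul]

lemma koszulD_map (g : Fin s → S) (φ : X →ₗ[S] Y) (z : Finset (Fin s) → X) :
    koszulD Y g (φ.compLeft _ z) = φ.compLeft _ (koszulD X g z) := by
  funext P
  simp [koszulD_apply, LinearMap.compLeft_apply]

end Koszul

/-! ### The Koszul-Čech double complex. -/

section KoszulCech

variable {S M : Type*} [CommRing S] [AddCommGroup M] [Module S M] {r s : ℕ}
  {𝒮 : ℤ → AddSubgroup S} [SetLike.GradedMonoid 𝒮]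
  {ℳ : ℤ → AddSubgroup M} [SetLike.GradedSMul 𝒮 ℳ] {f : Fin r → S}

lemma exists_cechLoc_inverse {J : Finset (Fin r)} {j : Fin r} (hj : j ∈ J) {e : ℤ}
    (he : f j ∈ 𝒮 e) : ∃ δ : CechLoc M f J →ₗ[S] CechLoc M f J, (∀ x, δ (f j • x) = x) ∧
      ∀ n, ∀ x ∈ cechLocDegree 𝒮 ℳ f J n, δ x ∈ cechLocDegree 𝒮 ℳ f J (n - e) := by
  refine ⟨LocalizedModule.divBy ⟨f j, Submonoid.subset_closure ⟨j, hj, rfl⟩⟩,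
    LocalizedModule.divBy_mul_by _, ?_⟩
  rintro n _ ⟨d, t, m, ht, hm, rfl⟩
  refine ⟨e + d, ⟨f j, Submonoid.subset_closure ⟨j, hj, rfl⟩⟩ * t, m,
    SetLike.GradedMul.mul_mem he ht, ?_, ?_⟩
  · rwa [show n - e + (e + d) = n + d by ring]
  · rw [LocalizedModule.divBy_apply, LocalizedModule.liftOn_mk, mul_comm]

variable (𝒮 ℳ f s) in
/-- The component of the Koszul-Čech double complex in Čech degree `i`, Koszul degree `p` and
internal degree `n`. -/
def koszulCech (n : ℤ) (i p : ℕ) : AddSubgroup (Finset (Fin s) → CechCochain M f i) where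
  carrier := {z | ∀ P, z P ∈ cechDegree 𝒮 ℳ f i (n - p) ∧ (P.card ≠ p → z P = 0)}
  zero_mem' P := ⟨zero_mem _, fun _ => rfl⟩
  add_mem' {z w} hz hw P := ⟨add_mem (hz P).1 (hw P).1, fun h => by
    rw [Pi.add_apply, (hz P).2 h, (hw P).2 h, add_zero]⟩
  neg_mem' {z} hz P := ⟨neg_mem (hz P).1, fun h => by
    rw [Pi.neg_apply, (hz P).2 h, neg_zero]⟩

lemma compLeft_cechD_mem {n : ℤ} {i p : ℕ} {z : Finset (Fin s) → CechCochain M f i}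
    (hz : z ∈ koszulCech s 𝒮 ℳ f n i p) :
    (cechD M f i).compLeft _ z ∈ koszulCech s 𝒮 ℳ f n (i + 1) p := fun P =>
  ⟨cechD_mem (hz P).1, fun h => by
    rw [LinearMap.compLeft_apply, Function.comp_apply, (hz P).2 h, map_zero]⟩

lemma koszulD_mem {g : Fin s → S} (hg : ∀ p, g p ∈ 𝒮 1) {n : ℤ} {i p : ℕ}
    {z : Finset (Fin s) → CechCochain M f i} (hz : z ∈ koszulCech s 𝒮 ℳ f n i (p + 1)) :
    koszulD _ g z ∈ koszulCech s 𝒮 ℳ f n i p := by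
  intro P
  rw [koszulD_apply]
  constructor
  · refine sum_mem fun q _ => ?_
    rw [mul_smul]
    refine cechSign_smul_mem _ _ _ ?_
    have := smul_mem_cechDegree (hg q) (hz (insert q P)).1
    rwa [show n - (p + 1 : ℕ) + 1 = n - p by push_cast; ring] at this
  · intro h
    refine Finset.sum_eq_zero fun q hq => ?_
    rw [(hz (insert q P)).2, smul_zero]
    rw [Finset.card_insert_of_notMem (Finset.mem_compl.mp hq)]
    omega

/-- In positive Čech degree some `f j = ∑ c p * g p` is invertible on each component, so
`koszul_homotopy` divided by `f j` contracts the Koszul complex. The degrees of `c` and of the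
division add up to -1. -/
lemma koszulCech_exact {g : Fin s → S}
    (hgf : ∀ j, ∃ e : ℤ, f j ∈ 𝒮 e ∧ ∃ c : Fin s → S, (∀ p, c p ∈ 𝒮 (e - 1)) ∧
      ∑ p, c p * g p = f j) {n : ℤ} {i p : ℕ} {z : Finset (Fin s) → CechCochain M f (i + 1)}
    (hz : z ∈ koszulCech s 𝒮 ℳ f n (i + 1) p) (hd : koszulD _ g z = 0) :
    ∃ w ∈ koszulCech s 𝒮 ℳ f n (i + 1) (p + 1), koszulD _ g w = z := by
  have key : ∀ J : {J : Finset (Fin r) // J.card = i + 1},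
      ∃ w : Finset (Fin s) → CechLoc M f J.1,
        (∀ P, w P ∈ cechLocDegree 𝒮 ℳ f J.1 (n - (p + 1 : ℕ)) ∧ (P.card ≠ p + 1 → w P = 0)) ∧
        koszulD _ g w = fun P => z P J := by
    intro J
    obtain ⟨j, hj⟩ : J.1.Nonempty := Finset.card_pos.mp (by rw [J.2]; exact Nat.succ_pos i)
    obtain ⟨e, he, c, hc, hcg⟩ := hgf j
    obtain ⟨δ, hδ, hδd⟩ := exists_cechLoc_inverse (M := M) (ℳ := ℳ) hj he
    have hzJ : koszulD _ g (fun P => z P J) = 0 := by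
      have := koszulD_map g (LinearMap.proj (R := S) (φ := fun J : {J : Finset (Fin r) //
        J.card = i + 1} => CechLoc M f J.1) J) z
      rw [hd, map_zero] at this
      exact this
    refine ⟨δ.compLeft _ (koszulH _ c fun P => z P J), fun P => ?_, ?_⟩
    · rw [LinearMap.compLeft_apply, Function.comp_apply, koszulH_apply]
      constructor
      · have : ∑ q ∈ P, (cechSign S q P * c q) • z (P.erase q) J ∈
            cechLocDegree 𝒮 ℳ f J.1 (n - p + (e - 1)) := by
          refine sum_mem fun q _ => ?_
          rw [mul_smul]
          exact cechSign_smul_mem _ _ _ (smul_mem_cechLocDegree (hc q) ((hz _).1 J trivial))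
        have := hδd _ _ this
        rwa [show n - p + (e - 1) - e = n - (p + 1 : ℕ) by push_cast; ring] at this
      · intro hP
        rw [Finset.sum_eq_zero, map_zero]
        intro q hq
        rw [(hz _).2, Pi.zero_apply, smul_zero]
        rw [Finset.card_erase_of_mem hq]
        have := Finset.card_pos.mpr ⟨q, hq⟩
        omega
    · have := koszul_homotopy g c (fun P => z P J)
      rw [hzJ, map_zero, add_zero, hcg] at this
      rw [koszulD_map, this]
      funext P
      exact hδ _
  choose w hw hwz using key
  refine ⟨fun P J => w J P, fun P => ⟨fun J _ => (hw J P).1, fun h => funext fun J =>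
    (hw J P).2 h⟩, ?_⟩
  funext P J
  have := koszulD_map g (LinearMap.proj (R := S) (φ := fun J : {J : Finset (Fin r) //
    J.card = i + 1} => CechLoc M f J.1) J) (fun P J => w J P)
  have h2 := (congrFun this P).symm.trans (congrFun (hwz J) P)
  exact h2

lemma exists_cechD_eq {n : ℤ} {i p : ℕ} (hv : CechVanishes 𝒮 ℳ f (i + 1) (n - p))
    {z : Finset (Fin s) → CechCochain M f (i + 1)} (hz : z ∈ koszulCech s 𝒮 ℳ f n (i + 1) p)
    (hd : (cechD M f (i + 1)).compLeft _ z = 0) :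
    ∃ y ∈ koszulCech s 𝒮 ℳ f n i p, (cechD M f i).compLeft _ y = z := by
  have key : ∀ P, ∃ y : CechCochain M f i, (y ∈ cechDegree 𝒮 ℳ f i (n - p) ∧
      (P.card ≠ p → y = 0)) ∧ cechD M f i y = z P := by
    intro P
    by_cases hP : P.card = p
    · obtain ⟨y, hy, hyz⟩ := hv (z P) (hz P).1 (congrFun hd P)
      exact ⟨y, ⟨hy, fun h => absurd hP h⟩, hyz⟩
    · exact ⟨0, ⟨zero_mem _, fun _ => rfl⟩, by rw [map_zero, (hz P).2 hP]⟩
  choose y hy hyz using key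
  exact ⟨y, hy, funext hyz⟩

/-- Descending induction on `i` along the diagonal, starting where the Čech complex is 0. Koszul
exactness writes `d x` as the Koszul boundary of some `x'` one step up; the induction corrects `x'`
to a Čech cocycle, and the vanishing hypothesis bounds it by the required `y`. -/
lemma exists_koszul_correction {g : Fin s → S} (hg : ∀ p, g p ∈ 𝒮 1)
    (hgf : ∀ j, ∃ e : ℤ, f j ∈ 𝒮 e ∧ ∃ c : Fin s → S, (∀ p, c p ∈ 𝒮 (e - 1)) ∧
      ∑ p, c p * g p = f j) {n : ℤ} (hv : ∀ i : ℕ, CechVanishes 𝒮 ℳ f i (n - i)) (k : ℕ) :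
    ∀ i : ℕ, r + 1 ≤ i + k → ∀ x ∈ koszulCech s 𝒮 ℳ f n i i,
      koszulD _ g ((cechD M f i).compLeft _ x) = 0 →
      ∃ y ∈ koszulCech s 𝒮 ℳ f n i (i + 1), (cechD M f i).compLeft _ (x - koszulD _ g y) = 0 := by
  have hdd : ∀ (i : ℕ) (x : Finset (Fin s) → CechCochain M f i),
      (cechD M f (i + 1)).compLeft _ ((cechD M f i).compLeft _ x) = 0 :=
    fun i x => funext fun P => cechD_cechD f i (x P)
  induction k with
  | zero =>
    intro i hi x _ _
    refine ⟨0, zero_mem _, ?_⟩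
    funext P J
    have := J.2 ▸ Finset.card_le_univ J.1
    rw [Fintype.card_fin] at this
    omega
  | succ k ih =>
    intro i hi x hx hdx
    obtain ⟨x', hx', hxx'⟩ := koszulCech_exact hgf (compLeft_cechD_mem hx) hdx
    obtain ⟨y', hy', hy⟩ := ih (i + 1) (by omega) x' hx' (by rw [koszulD_map, hxx', hdd])
    obtain ⟨y, hy1, hy2⟩ := exists_cechD_eq (hv (i + 1)) (sub_mem hx' (koszulD_mem hg hy')) hy
    refine ⟨y, hy1, ?_⟩
    rw [map_sub, ← koszulD_map, hy2, map_sub, koszulD_koszulD, sub_zero, hxx', sub_self]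

/-- If the cohomology vanishes in the degrees that Castelnuovo-Mumford regularity prescribes,
there are no generators in degree `n`. -/
lemma eq_zero_of_vanishes (h𝒮 : ∀ a b, a ≠ b → Disjoint (𝒮 a) (𝒮 b)) {g : Fin s → S}
    (hg : ∀ p, g p ∈ 𝒮 1)
    (hgf : ∀ j, ∃ e : ℤ, f j ∈ 𝒮 e ∧ ∃ c : Fin s → S, (∀ p, c p ∈ 𝒮 (e - 1)) ∧
      ∑ p, c p * g p = f j) {n : ℤ} (hv : ∀ i : ℕ, CechVanishes 𝒮 ℳ f i (n - i))
    (h : ∀ m ∈ ℳ (n - 1), m = 0) (m : M) (hm : m ∈ ℳ n) : m = 0 := by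
  let z : CechCochain M f 0 := fun J => LocalizedModule.mk m 1
  have hz : z ∈ cechDegree 𝒮 ℳ f 0 n := fun J _ =>
    ⟨0, 1, m, SetLike.GradedOne.one_mem, by rwa [add_zero], rfl⟩
  -- The element `m` in Koszul degree 0. Its correction `y` has Koszul degree 1 and entries of
  -- degree `n - 1`, hence is 0, so `m` itself is a class in `H⁰` of degree `n`.
  let x : Finset (Fin s) → CechCochain M f 0 := fun P => if P = ∅ then z else 0
  have hx : x ∈ koszulCech s 𝒮 ℳ f n 0 0 := by
    intro P
    rw [Nat.cast_zero, sub_zero]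
    simp only [x]
    split_ifs with hP
    · exact ⟨hz, fun hc => absurd (Finset.card_eq_zero.mpr hP) hc⟩
    · exact ⟨zero_mem _, fun _ => rfl⟩
  have hx0 : koszulD _ g ((cechD M f 0).compLeft _ x) = 0 := by
    rw [koszulD_map]
    funext P
    rw [LinearMap.compLeft_apply, Function.comp_apply, koszulD_apply, Finset.sum_eq_zero]
    · rw [map_zero, Pi.zero_apply]
    · intro p _
      simp only [x]
      rw [if_neg (Finset.insert_ne_empty p P), smul_zero]
  obtain ⟨y, hy, hxy⟩ := exists_koszul_correction hg hgf hv (r + 1) 0 (by omega) x hx hx0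
  have hy0 : y = 0 := by
    funext P
    exact eq_zero_of_mem_cechDegree_zero h𝒮 h (by simpa using (hy P).1)
  rw [hy0, map_zero, sub_zero] at hxy
  have h1 := hv 0 z (by simpa using hz) (by simpa [x] using congrFun hxy ∅)
  have h2 : z = 0 := AddSubgroup.mem_bot.mp h1
  have h3 : (LocalizedModule.mk m 1 : CechLoc M f ∅) = 0 := congrFun h2 ⟨∅, rfl⟩
  rw [← LocalizedModule.zero_mk 1, LocalizedModule.mk_eq] at h3
  obtain ⟨u, hu⟩ := h3
  have hu1 : u.1 = 1 := by
    have : u.1 ∈ Submonoid.closure (f '' ((∅ : Finset (Fin r)) : Set (Fin r))) := u.2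
    simpa using this
  simpa [Submonoid.smul_def, hu1] using hu

end KoszulCech

/-! ### The Rees algebra, `𝔪R(I)` and the two exact sequences. -/

section Rees

variable {A : Type*} [CommRing A]

/-- The projection of a polynomial to its component of degree `n`. -/
def polyProj (A : Type*) [CommRing A] : ℤ → A[X] →+ A[X]
  | Int.ofNat m => (monomial m).toAddMonoidHom.comp (lcoeff A m).toAddMonoidHom
  | Int.negSucc _ => 0

lemma coeff_polyProj (n : ℤ) (p : A[X]) (k : ℕ) :
    (polyProj A n p).coeff k = if (k : ℤ) = n then p.coeff k else 0 := by
  cases n with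
  | ofNat m =>
    change (monomial m (p.coeff m)).coeff k = _
    rw [coeff_monomial]
    by_cases h : m = k
    · subst h
      simp
    · rw [if_neg h, if_neg]
      simp only [Int.ofNat_eq_natCast, Nat.cast_inj]
      exact Ne.symm h
  | negSucc m =>
    rw [if_neg (by omega)]
    rfl

/-- The projection of the Rees algebra to its component of degree `n`. -/
def reesProj (I : Ideal A) (n : ℤ) : reesAlgebra I →+ reesAlgebra I where
  toFun s := ⟨polyProj A n s, fun k => by
    rw [coeff_polyProj]
    split_ifs
    · exact s.2 k
    · exact zero_mem _⟩
  map_zero' := Subtype.ext (map_zero _)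
  map_add' s t := Subtype.ext (map_add _ (s : A[X]) t)

lemma coeff_reesProj (I : Ideal A) (n : ℤ) (s : reesAlgebra I) (k : ℕ) :
    (reesProj I n s : A[X]).coeff k = if (k : ℤ) = n then (s : A[X]).coeff k else 0 :=
  coeff_polyProj n _ k

lemma isGradedProjection_reesProj (I : Ideal A) :
    IsGradedProjection (reesDegree I) (reesProj I) where
  mem n s k hk := by
    change (reesProj I n s : A[X]).coeff k = 0
    rw [coeff_reesProj, if_neg hk]
  of_mem n s hs := by
    ext k
    rw [coeff_reesProj]
    split_ifs with h
    · rfl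
    · exact (hs k h).symm
  of_mem_ne m n hmn s hs := by
    ext k
    rw [coeff_reesProj]
    split_ifs with h
    · exact hs k (by omega)
    · rfl
  mul d s hs n t := by
    ext k
    rw [coeff_reesProj]
    have hmem : (s : A[X]) * (reesProj I n t : A[X]) ∈ polyDegree A (d + n) :=
      polyDegree_mul hs fun k hk => by rw [coeff_reesProj, if_neg hk]
    split_ifs with h
    · rw [MulMemClass.coe_mul, MulMemClass.coe_mul, coeff_mul, coeff_mul]
      refine Finset.sum_congr rfl fun x hx => ?_
      rw [Finset.HasAntidiagonal.mem_antidiagonal] at hx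
      rw [coeff_reesProj]
      by_cases hx1 : (x.1 : ℤ) = d
      · rw [if_pos (by omega)]
      · rw [show (s : A[X]).coeff x.1 = 0 from hs x.1 hx1, zero_mul, zero_mul]
    · exact (hmem k (by omega)).symm

lemma reesDegree_neg_one_eq_zero (I : Ideal A) {s : reesAlgebra I} (hs : s ∈ reesDegree I (-1)) :
    s = 0 := by
  ext k
  exact hs k (by omega)

/-- The element `a tᵏ` of the Rees algebra. -/
def reesMonomial {I : Ideal A} (k : ℕ) {a : A} (ha : a ∈ I ^ k) : reesAlgebra I :=
  ⟨monomial k a, reesAlgebra.monomial_mem.mpr ha⟩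

lemma coe_reesMonomial {I : Ideal A} (k : ℕ) {a : A} (ha : a ∈ I ^ k) :
    (reesMonomial k ha : A[X]) = monomial k a := rfl

lemma exists_reesAlgebra_linear_generators [IsNoetherianRing A] (I : Ideal A) :
    ∃ (s : ℕ) (g : Fin s → reesAlgebra I), (∀ p, g p ∈ reesDegree I 1) ∧
      ∀ e : ℤ, 0 < e → ∀ x ∈ reesDegree I e, ∃ c : Fin s → reesAlgebra I,
        (∀ p, c p ∈ reesDegree I (e - 1)) ∧ ∑ p, c p * g p = x := by
  obtain ⟨s, b, hb⟩ := Submodule.fg_iff_exists_fin_generating_family.mp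
    (IsNoetherian.noetherian I)
  have hb1 : ∀ p, b p ∈ I ^ 1 := fun p => by
    rw [pow_one, ← hb]
    exact Submodule.subset_span ⟨p, rfl⟩
  have hmono : ∀ (n : ℕ) (a : A), monomial n a ∈ polyDegree A n := by
    intro n a k hk
    rw [coeff_monomial, if_neg]
    rintro rfl
    exact hk rfl
  refine ⟨s, fun p => reesMonomial 1 (hb1 p), fun p => hmono 1 (b p), ?_⟩
  intro e he x hx
  obtain ⟨m, rfl⟩ : ∃ m : ℕ, e = m + 1 := ⟨(e - 1).toNat, by omega⟩
  have hxm : (x : A[X]).coeff (m + 1) ∈ I ^ m • Submodule.span A (Set.range b) := by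
    rw [hb, smul_eq_mul, ← pow_succ]
    exact x.2 (m + 1)
  obtain ⟨a, ha, hsum⟩ := (Submodule.mem_ideal_smul_span_iff_exists_sum _ _ _).mp hxm
  refine ⟨fun p => reesMonomial m (ha p), fun p => ?_, ?_⟩
  · rw [add_sub_cancel_right]
    exact hmono m (a p)
  · rw [Finsupp.sum_fintype _ _ (fun p => zero_smul A (b p))] at hsum
    ext k
    rw [AddSubmonoidClass.coe_finsetSum, finsetSum_coeff]
    have : ∀ p, ((reesMonomial m (ha p) *
        reesMonomial 1 (hb1 p) : reesAlgebra I) : A[X]).coeff k =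
        if m + 1 = k then a p • b p else 0 := by
      intro p
      rw [MulMemClass.coe_mul, coe_reesMonomial, coe_reesMonomial, monomial_mul_monomial,
        coeff_monomial, smul_eq_mul]
    rw [Finset.sum_congr rfl fun p _ => this p]
    by_cases hk : m + 1 = k
    · subst hk
      simpa using hsum
    · simp only [if_neg hk, Finset.sum_const_zero]
      exact (hx k (by omega)).symm

/-- A graded module over the Rees algebra that lives in nonnegative degrees and is not zero in
degree `0` has nonnegative regularity. -/
lemma exists_not_vanishes [IsNoetherianRing A] (I : Ideal A) {r : ℕ} {f : Fin r → reesAlgebra I}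
    (hf : IsPositiveGenerators (reesDegree I) f) {M : Type*} [AddCommGroup M]
    [Module (reesAlgebra I) M] (ℳ : ℤ → AddSubgroup M) [SetLike.GradedSMul (reesDegree I) ℳ]
    (h : ∀ m ∈ ℳ (-1), m = 0) {m : M} (hm : m ∈ ℳ 0) (hm0 : m ≠ 0) :
    ∃ i : ℕ, ¬ CechVanishes (reesDegree I) ℳ f i (-i) := by
  by_contra! hv
  obtain ⟨s, g, hg, hgen⟩ := exists_reesAlgebra_linear_generators I
  refine hm0 (eq_zero_of_vanishes (f := f) (isGradedProjection_reesProj I).disjoint hg ?_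
    (n := 0) (fun i => by rw [zero_sub]; exact hv i) (by simpa using h) m hm)
  intro j
  obtain ⟨e, he, hj⟩ := hf.homogeneous j
  exact ⟨e, hj, hgen e he _ hj⟩

variable [IsLocalRing A]

lemma mem_of_mem_maximalIdeal_mul {J : Ideal A} {a : A} (h : a ∈ maximalIdeal A * J) : a ∈ J :=
  Ideal.mul_le_right h

/-- Coefficientwise, `𝔪R(I) = ⨁ 𝔪Iᵏtᵏ`; this is what matches it with `R(𝓕)` after a shift by `t`. -/
lemma mem_maximalExt_iff (I : Ideal A) (p : reesAlgebra I) :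
    p ∈ maximalExt I ↔ ∀ k, (p : A[X]).coeff k ∈ maximalIdeal A * I ^ k := by
  constructor
  · let T : Ideal (reesAlgebra I) :=
      { carrier := {p | ∀ k, (p : A[X]).coeff k ∈ maximalIdeal A * I ^ k}
        zero_mem' := by simp
        add_mem' := fun {p q} hp hq k => by
          rw [AddMemClass.coe_add, coeff_add]
          exact add_mem (hp k) (hq k)
        smul_mem' := fun c p hp k => by
          rw [smul_eq_mul, MulMemClass.coe_mul, coeff_mul]
          refine sum_mem ?_
          rintro ⟨a, b⟩ hab
          rw [Finset.HasAntidiagonal.mem_antidiagonal] at hab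
          have := Ideal.mul_mem_mul (c.2 a) (hp b)
          rwa [mul_left_comm, ← pow_add, hab] at this }
    have : maximalExt I ≤ T := by
      refine Ideal.map_le_iff_le_comap.mpr fun a ha k => ?_
      change (C a).coeff k ∈ _
      rw [coeff_C]
      split_ifs with h
      · simpa [h] using ha
      · exact zero_mem _
    exact fun hp => this hp
  · intro h
    have key : ∀ (k : ℕ) (a : A), a ∈ maximalIdeal A * I ^ k →
        ∀ ha : a ∈ I ^ k, reesMonomial k ha ∈ maximalExt I := by
      intro k a ha
      induction ha using Submodule.mul_induction_on' with
      | mem_mul_mem x hx y hy =>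
        intro hxy
        have h1 : algebraMap A (reesAlgebra I) x ∈ maximalExt I := Ideal.mem_map_of_mem _ hx
        have h2 : reesMonomial k hxy = algebraMap A (reesAlgebra I) x * reesMonomial k hy := by
          refine Subtype.ext ?_
          change monomial k (x * y) = C x * monomial k y
          rw [C_mul_monomial]
        rw [h2]
        exact Ideal.mul_mem_right _ _ h1
      | add x hx y hy h1 h2 =>
        intro hxy
        have hx' : x ∈ I ^ k := mem_of_mem_maximalIdeal_mul hx
        have hy' : y ∈ I ^ k := mem_of_mem_maximalIdeal_mul hy
        have h3 : reesMonomial k hxy = reesMonomial k hx' + reesMonomial k hy' :=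
          Subtype.ext (map_add (monomial k) x y)
        rw [h3]
        exact add_mem (h1 hx') (h2 hy')
    have hp : p = ∑ k ∈ (p : A[X]).support, reesMonomial k (p.2 k) := by
      refine Subtype.ext ?_
      rw [AddSubmonoidClass.coe_finsetSum]
      exact (p : A[X]).as_sum_support
    rw [hp]
    exact sum_mem fun k _ => key k _ (h k) (p.2 k)

instance (I : Ideal A) : AddCommGroup (maximalExt I) := Submodule.addCommGroup (maximalExt I)

instance (I : Ideal A) : Module (reesAlgebra I) (maximalExt I) := Submodule.module (maximalExt I)

/-- The component of degree `n` of `𝔪 R(I)`. -/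
def maximalExtDegree (I : Ideal A) (n : ℤ) : AddSubgroup (maximalExt I) :=
  (reesDegree I n).comap (maximalExt I).subtype.toAddMonoidHom

instance (I : Ideal A) : SetLike.GradedSMul (reesDegree I) (maximalExtDegree I) where
  smul_mem _ _ _ _ hp hq := polyDegree_mul hp hq

lemma gradedExact_fiberCone (I : Ideal A) :
    GradedExact (maximalExtDegree I) (reesDegree I) (fiberConeDegree I) 0
      (Submodule.subtype (maximalExt I)) (toFiberCone I) where
  injective := Submodule.subtype_injective _
  exact x := by
    rw [Submodule.coe_subtype, Subtype.range_coe]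
    exact Submodule.Quotient.mk_eq_zero _
  mem_iff n x := by
    rw [add_zero]
    rfl
  map_mem n x hx := ⟨x, hx, rfl⟩
  exists_lift n y hy := hy

/-- Multiplication by the variable, `𝔪 R(I) → R(𝓕)`. -/
def maximalExtShift (I : Ideal A) (hI : I ≠ ⊤) :
    maximalExt I →ₗ[reesAlgebra I] filtrationRees I hI where
  toFun p := ⟨X * (p.1 : A[X]), fun n => by
    rw [coeff_X_mul]
    exact (mem_maximalExt_iff I p.1).mp p.2 n⟩
  map_add' p q := Subtype.ext (mul_add X (p.1 : A[X]) q.1)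
  map_smul' c p := Subtype.ext (mul_left_comm X (c : A[X]) p.1)

lemma maximalExtShift_coe (I : Ideal A) (hI : I ≠ ⊤) (p : maximalExt I) :
    (maximalExtShift I hI p : A[X]) = X * (p.1 : A[X]) := rfl

lemma mem_range_maximalExtShift (I : Ideal A) (hI : I ≠ ⊤) (x : filtrationRees I hI)
    (hx : (x : A[X]).coeff 0 = 0) : x ∈ LinearMap.range (maximalExtShift I hI) := by
  have h1 : divX (x : A[X]) ∈ reesAlgebra I := fun k => by
    rw [coeff_divX]
    exact mem_of_mem_maximalIdeal_mul (x.2 k)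
  refine ⟨⟨⟨divX (x : A[X]), h1⟩, (mem_maximalExt_iff I _).mpr fun k => ?_⟩, ?_⟩
  · change (divX (x : A[X])).coeff k ∈ _
    rw [coeff_divX]
    exact x.2 k
  · refine Subtype.ext ?_
    rw [maximalExtShift_coe]
    conv_rhs => rw [← X_mul_divX_add (x : A[X]), hx, C_0, add_zero]

lemma maximalExtShift_injective (I : Ideal A) (hI : I ≠ ⊤) :
    Function.Injective (maximalExtShift I hI) := by
  intro p q h
  refine Subtype.ext (Subtype.ext ?_)
  ext k
  have := congrArg (fun x : filtrationRees I hI => (x : A[X]).coeff (k + 1)) h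
  simpa only [maximalExtShift_coe, coeff_X_mul] using this

lemma maximalExtShift_mem_iff (I : Ideal A) (hI : I ≠ ⊤) (n : ℤ) (p : maximalExt I) :
    maximalExtShift I hI p ∈ filtrationReesDegree I hI (n + 1) ↔ p ∈ maximalExtDegree I n := by
  constructor
  · intro h k hk
    have := h (k + 1) (by push_cast; omega)
    change (X * (p.1 : A[X])).coeff (k + 1) = 0 at this
    rwa [coeff_X_mul] at this
  · intro h k hk
    change (X * (p.1 : A[X])).coeff k = 0
    cases k with
    | zero => simp
    | succ k =>
      rw [coeff_X_mul]
      exact h k (by push_cast at hk; omega)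

/-- The cokernel of multiplication by `t` consists of constants. Its `H⁰` lives in degree `n + 1 =
0` and maps to `H¹(𝔪R(I))_{-1}`, the one place that must be excluded. -/
lemma vanishes_maximalExt (I : Ideal A) (hI : I ≠ ⊤) {r : ℕ} {f : Fin r → reesAlgebra I}
    (hf : IsPositiveGenerators (reesDegree I) f) {i : ℕ} {n : ℤ} (h : i = 1 → n ≠ -1)
    (hv : CechVanishes (reesDegree I) (filtrationReesDegree I hI) f i (n + 1)) :
    CechVanishes (reesDegree I) (maximalExtDegree I) f i n := by
  refine vanishes_of_smul_mem_range (isGradedProjection_reesProj I).disjoint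
    (fun j => (hf.homogeneous j).imp fun _ h => h.2) (maximalExtShift_injective I hI)
    (maximalExtShift_mem_iff I hI) (fun j x => ?_) (fun hi x hx => ?_) hv
  · refine mem_range_maximalExtShift I hI _ ?_
    obtain ⟨e, he, hj⟩ := hf.homogeneous j
    change ((f j : A[X]) * (x : A[X])).coeff 0 = 0
    have h0 : (f j : A[X]).coeff 0 = 0 := hj 0 (by omega)
    rw [mul_coeff_zero, h0, zero_mul]
  · exact mem_range_maximalExtShift I hI x (hx 0 (by have := h hi; omega))

end Rees

end FiberReg

end

/-! ### Comparison of the regularities. -/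

theorem mainTheorem5 {A : Type*} [CommRing A] [IsLocalRing A] [IsNoetherianRing A]
    (I : Ideal A) (hI : I ≠ ⊤)
    {r : ℕ} (f : Fin r → reesAlgebra I)
    (hf : FiberReg.IsPositiveGenerators (FiberReg.reesDegree I) f)
    (h : FiberReg.reg (FiberReg.reesDegree I) (FiberReg.filtrationReesDegree I hI) f ≤
      FiberReg.reg (FiberReg.reesDegree I) (FiberReg.reesDegree I) f) :
    FiberReg.reg (FiberReg.reesDegree I) (FiberReg.fiberConeDegree I) f =
      FiberReg.reg (FiberReg.reesDegree I) (FiberReg.reesDegree I) f := by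
  open FiberReg in
  have hf' : ∀ j, ∃ n : ℤ, f j ∈ reesDegree I n := fun j => (hf.homogeneous j).imp fun _ h => h.2
  have hone : (1 : reesAlgebra I) ∈ reesDegree I 0 := SetLike.GradedOne.one_mem
  obtain ⟨b, hb⟩ := exists_reg_le (isGradedProjection_reesProj I) hf.homogeneous
    fun n hn s hs => by
      rw [hf.span_eq]
      exact Ideal.subset_span ⟨n, hn, hs⟩
  obtain ⟨i₀, hi₀⟩ := exists_not_vanishes I hf (reesDegree I)
    (fun m hm => reesDegree_neg_one_eq_zero I hm) hone one_ne_zero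
  obtain ⟨i, n, hv, hreg⟩ := exists_reg_eq _ _ f hb hi₀
  have hpos : 0 ≤ n + i := by
    have := le_reg hi₀
    rw [hreg, EReal.coe_le_coe_iff, Int.cast_le] at this
    omega
  rw [hreg] at h ⊢
  have hR := (reg_le_iff _ _ f _).mp hreg.le
  have hRF := (reg_le_iff _ _ f _).mp h
  have hm : ∀ (j : ℕ) (m : ℤ), n + i < m + j + 1 → (j = 1 → m ≠ -1) →
      CechVanishes (reesDegree I) (maximalExtDegree I) f j m := by
    intro j m hlt hne
    exact vanishes_maximalExt I hI hf hne (hRF j (m + 1) (by omega))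
  have E := gradedExact_fiberCone I
  have hF : ∀ (j : ℕ) (m : ℤ), n + i < m + j →
      CechVanishes (reesDegree I) (fiberConeDegree I) f j m := by
    intro j m hlt
    -- The excluded pair `(j + 1, m) = (1, -1)` would give `n + i < -1`, against `hpos`.
    have := E.vanishes_right hf' (i := j) (n := m) (by rw [add_zero]; exact hR j m hlt)
      (hm (j + 1) m (by push_cast; omega) (by omega))
    rwa [add_zero] at this
  refine le_antisymm ((reg_le_iff _ _ f _).mpr hF) ?_
  rcases hpos.eq_or_lt with h0 | h0
  -- When the regularity is 0 the excluded pair may interfere, so the lower bound comes from `F(I)`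
  -- being nonzero in degree 0.
  · have hone' : toFiberCone I 1 ≠ 0 := by
      intro h1
      have h2 := (mem_maximalExt_iff I 1).mp ((Submodule.Quotient.mk_eq_zero _).mp h1) 0
      rw [OneMemClass.coe_one, coeff_one_zero, pow_zero, mul_one] at h2
      exact (Ideal.ne_top_iff_one _).mp (maximalIdeal.isMaximal A).ne_top h2
    obtain ⟨j, hj⟩ := exists_not_vanishes I hf (fiberConeDegree I) (by
      rintro _ ⟨s, hs, rfl⟩
      rw [reesDegree_neg_one_eq_zero I hs]
      exact map_zero (toFiberCone I)) ⟨1, hone, rfl⟩ hone'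
    have := le_reg hj
    rwa [neg_add_cancel, h0] at this
  -- Here `n + i > 0` rules out `(i, n) = (1, -1)`.
  · refine le_reg fun hvF => hv ?_
    have := E.vanishes_middle hf' (hm i n (by omega) (by omega)) (by rw [add_zero]; exact hvF)
    rwa [add_zero] at this
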